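/- Let $n\ge 2$ be an integer. For unit vectors $a_1,\dots,a_K\in\mathbb R^D$ ($K\ge 2$) let $A=[a_1|\dots|a_K]\in\mathbb R^{D\times K}$, $G_n=(\langle a_i,a_j\rangle^n)_{i,j=1}^K$, $\mathcal A=\operatorname{Span}\{a_1^{\otimes n},\dots,a_K^{\otimes n}\}$ and $\varepsilon_K=K\log^n(K)/D^n$. For an integer $1\le p\le K$ and $\delta\in(0,1)$, $A$ is called $(p,\delta)$-RIP if $\|A_p^\top A_p-I_p\|_2\le\delta$ for every $D\times p$ submatrix $A_p$ of $A$. Consider, for constants $c_\delta,c_1,c_2>0$, the assumptions (A1) $A$ is $(\lceil c_\delta D/\log K\rceil,\delta)$-RIP; (A2) $\langle a_i,a_j\rangle^2\le c_1\log(K)/D$ for all $i\ne j$; (A3) $G_n$ is invertible and $\|G_n^{-1}\|_2\le c_2$. For a subspace $\hat{\mathcal A}$ of the space of symmetric tensors in $(\mathbb R^D)^{\otimes n}$ let $P_{\hat{\mathcal A}}$ be the orthogonal projector onto $\hat{\mathcal A}$ for the Frobenius inner product, $F_{\hat{\mathcal A}}(x)=\|P_{\hat{\mathcal A}}(x^{\otimes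 n})\|_F^2$, and $\Delta_{\mathcal A}=\|P_{\mathcal A}-P_{\hat{\mathcal A}}\|_{F\to F}$. A second-order critical point of the program $\max_{x\in\mathbb S^{D-1}}F_{\hat{\mathcal A}}(x)$ is a point of $\mathbb S^{D-1}$ at which the Riemannian gradient of $F_{\hat{\mathcal A}}$ on $\mathbb S^{D-1}$ is zero and its Riemannian Hessian is negative semidefinite. Given $n,c_1,c_2$ there is $\delta_0>0$ such that for each $c_\delta>0$ there are $C,\Delta_0>0$ with the following property. Let $K=K(D)$ be such that $\varepsilon_K\to0$ as $D\to\infty$. Then there is $D_0$ (depending on $n,c_1,c_2,c_\delta$ and on the sequence $K(D)$) such that, whenever $D>D_0$, $K=K(D)\ge 2$, $0<\delta<\delta_0$, the unit vectors $a_1,\dots,a_K\in\mathbb R^D$ satisfy (A1)-(A3), and $\Delta_{\mathcal A}\le\Delta_0$, the program $\max_{x\in\mathbb S^{D-1}}F_{\hat{\mathcal A}}(x)$ has exactly $2K$ second-order critical points in the superlevel set $$\{x\in\mathbb S^{D-1}:F_{\hat{\mathcal A}}(x)\ge C\varepsilon_K+5\Delta_{\mathcal A}\}.$$ Each of these critical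 points is a strict local maximizer of $F_{\hat{\mathcal A}}$ on $\mathbb S^{D-1}$, and for each such point $x^*$ there are unique $i\in\{1,\dots,K\}$ and $s\in\{-1,1\}$ with $$\|x^*-sa_i\|_2^2\le\frac{2\Delta_{\mathcal A}}{n}.$$ In particular, in the noiseless case $\Delta_{\mathcal A}=0$, the second-order critical points in the superlevel set are exactly the points $sa_i$ ($1\le i\le K$, $s\in\{-1,1\}$), and these are exactly the global maximizers. -/

import Mathlib

open Filter Topology

namespace SPM

noncomputable section

/-- `ℝ^D` with the Euclidean norm. -/
abbrev Vec (D : ℕ) : Type := EuclideanSpace ℝ (Fin D)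

/-- Real tensors of length `D` and order `n`, i.e. arrays indexed by `n`-tuples in `[D]`, with the
Frobenius inner product and norm. -/
abbrev Tensor (n D : ℕ) : Type := EuclideanSpace ℝ (Fin n → Fin D)

/-- The subspace of symmetric tensors. -/
def symTensors (n D : ℕ) : Submodule ℝ (Tensor n D) where
  carrier := {T | ∀ (σ : Equiv.Perm (Fin n)) (i : Fin n → Fin D), T (i ∘ σ) = T i}
  add_mem' := by
    intro S T hS hT σ i
    simp [hS σ i, hT σ i]
  zero_mem' := by
    intro σ i
    simp
  smul_mem' := by
    intro c T hT σ i
    simp [hT σ i]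

/-- The tensor power `x^{⊗ n}`. -/
def tensorPow (n : ℕ) {D : ℕ} (x : Vec D) : Tensor n D :=
  WithLp.toLp 2 fun i => ∏ k, x (i k)

/-- The unit sphere in `ℝ^D`. -/
def unitSphere (D : ℕ) : Set (Vec D) := Metric.sphere 0 1

/-- The subspace `Span {a_1^{⊗ n}, …, a_K^{⊗ n}}`. -/
def powSpan (n : ℕ) {D K : ℕ} (a : Fin K → Vec D) : Submodule ℝ (Tensor n D) :=
  Submodule.span ℝ (Set.range fun i => tensorPow n (a i))

/-- The SPM objective `F_B(x) = ‖P_B (x^{⊗ n})‖_F ^ 2` of a subspace `B` of tensors. -/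
def objective {n D : ℕ} (B : Submodule ℝ (Tensor n D)) (x : Vec D) : ℝ :=
  ‖B.starProjection (tensorPow n x)‖ ^ 2

/-- The subspace error `‖P_B - P_B'‖_{F → F}`, an operator norm. -/
def subspaceError {n D : ℕ} (B B' : Submodule ℝ (Tensor n D)) : ℝ :=
  ‖B.starProjection - B'.starProjection‖

/-- The Riemannian gradient `(I - x xᵀ) ∇f(x)` of `f` restricted to the unit sphere, at a point `x`
of the sphere. -/
def sphereGrad {D : ℕ} (f : Vec D → ℝ) (x : Vec D) : Vec D :=
  gradient f x - inner ℝ x (gradient f x) • x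

/-- The quadratic form `z ↦ zᵀ ∇²_S f(x) z` of the Riemannian Hessian
`(I - x xᵀ) (∇²f(x) - (xᵀ ∇f(x)) I) (I - x xᵀ)` of `f` restricted to the unit sphere, at a point
`x` of the sphere, evaluated at a tangent vector `z`, that is, at `z` orthogonal to `x`. -/
def sphereHess {D : ℕ} (f : Vec D → ℝ) (x z : Vec D) : ℝ :=
  fderiv ℝ (fderiv ℝ f) x z z - inner ℝ x (gradient f x) * ‖z‖ ^ 2

/-- `x` is a (first- and) second-order critical point of `max f` over the unit sphere: the
Riemannian gradient vanishes and the Riemannian Hessian is negative semidefinite on the tangent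
space. -/
def IsSecondOrderCritical {D : ℕ} (f : Vec D → ℝ) (x : Vec D) : Prop :=
  x ∈ unitSphere D ∧ sphereGrad f x = 0 ∧
    ∀ z : Vec D, inner ℝ x z = 0 → sphereHess f x z ≤ 0

/-- `x` is a strict local maximizer of `f` restricted to the unit sphere. -/
def IsStrictLocalMaxOnSphere {D : ℕ} (f : Vec D → ℝ) (x : Vec D) : Prop :=
  x ∈ unitSphere D ∧ ∀ᶠ y in 𝓝 x, y ∈ unitSphere D → y ≠ x → f y < f x

/-- The spectral norm of a square matrix. -/
def specNorm {p : ℕ} (M : Matrix (Fin p) (Fin p) ℝ) : ℝ :=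
  ‖Matrix.toEuclideanCLM (𝕜 := ℝ) M‖

/-- The matrix `[a_1 | … | a_K]`. -/
def colMatrix {D K : ℕ} (a : Fin K → Vec D) : Matrix (Fin D) (Fin K) ℝ :=
  Matrix.of fun r i => a i r

/-- `A` is `(p, δ)`-RIP: `1 ≤ p ≤ K`, `δ ∈ (0, 1)`, and `‖A_pᵀ A_p - I_p‖₂ ≤ δ` for each `D × p`
submatrix `A_p` of `A`. -/
def IsRIP {D K : ℕ} (A : Matrix (Fin D) (Fin K) ℝ) (p : ℕ) (δ : ℝ) : Prop :=
  1 ≤ p ∧ p ≤ K ∧ 0 < δ ∧ δ < 1 ∧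
    ∀ e : Fin p ↪ Fin K,
      specNorm ((A.submatrix id e).transpose * A.submatrix id e - 1) ≤ δ

/-- The Grammian `(G_n)_{ij} = ⟨a_i, a_j⟩ ^ n`. -/
def grammian (n : ℕ) {D K : ℕ} (a : Fin K → Vec D) : Matrix (Fin K) (Fin K) ℝ :=
  Matrix.of fun i j => (inner ℝ (a i) (a j)) ^ n

/-- The restricted isometry assumption: `A` is `(⌈c_δ D / log K⌉, δ)`-RIP. -/
def AssumptionRIP {D K : ℕ} (a : Fin K → Vec D) (cδ δ : ℝ) : Prop :=
  IsRIP (colMatrix a) ⌈cδ * D / Real.log K⌉₊ δ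

/-- The correlation assumption: `⟨a_i, a_j⟩² ≤ c₁ log K / D` for all `i ≠ j`. -/
def AssumptionCorrelation {D K : ℕ} (a : Fin K → Vec D) (c₁ : ℝ) : Prop :=
  ∀ i j, i ≠ j → (inner ℝ (a i) (a j)) ^ 2 ≤ c₁ * Real.log K / D

/-- The Grammian assumption: `G_n` is invertible and `‖G_n⁻¹‖₂ ≤ c₂`. -/
def AssumptionGrammian (n : ℕ) {D K : ℕ} (a : Fin K → Vec D) (c₂ : ℝ) : Prop :=
  IsUnit (grammian n a).det ∧ specNorm (grammian n a)⁻¹ ≤ c₂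

/-- `ε_K = K log^n K / D^n`. -/
def epsK (n K D : ℕ) : ℝ := K * Real.log K ^ n / (D : ℝ) ^ n

/-- The second-order critical points of the objective of `B` over the unit sphere in the superlevel
set where the objective is at least `ℓ`. -/
def criticalAbove {n D : ℕ} (B : Submodule ℝ (Tensor n D)) (ℓ : ℝ) : Set (Vec D) :=
  {x | IsSecondOrderCritical (objective B) x ∧ ℓ ≤ objective B x}

/-- The set `{s a_i : i ∈ [K], s ∈ {-1, 1}}`. -/
def signedComponents {D K : ℕ} (a : Fin K → Vec D) : Set (Vec D) :=
  {x | ∃ (i : Fin K) (s : ℤˣ), x = ((s : ℤ) : ℝ) • a i}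

end

end SPM

/-! Write `F` for the noiseless objective, the squared norm of the projection of `x^{⊗ n}` onto
`Span {a_j^{⊗ n}}`, and expand this projection as `∑ σ_j a_j^{⊗ n}`. In the orthonormal case
`σ_j = ⟨a_j, x⟩^n`, and the landscape can be read off from the coordinates of `x`. The proof shows
that the same computation survives with errors that are small relative to `F` on the superlevel set.

* *Error control.* Let `β` be a suitable constant multiple of `log K / D`. The Gram equation
  `σ_j = ⟨a_j, x⟩^n - ∑_{k ≠ j} σ_k ⟨a_k, a_j⟩^n`, the correlation bound `⟨a_k, a_j⟩² ≤ β` and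
  `‖σ‖² ≤ c F` (from the bound on the inverse Grammian) give
  `|σ_j - ⟨a_j, x⟩^n| ≤ √(c F K β^n)`, where `K β^n` is a multiple of `ε_K`
  (`IsIncoherentSystem.exists_isExpansion`). By restricted isometry at most `p` indices have
  `⟨a_j, x⟩² > β`; over these, squared correlations sum to at most `1 + δ`, and the remaining
  indices contribute another `√(c F K β^n)`. When `F ≥ C ε_K` with `C` large, this is a small
  multiple of `F`.

* *Localization.* Let `x` be a second-order critical point in the superlevel set and let `i`
  maximize `u = ⟨a_i, x⟩²`. Then `F ≲ u^{n-1}`, whereas the second-order condition in the tangent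
  direction `a_i - ⟨a_i, x⟩ x` gives `(2 n - 1) u^{n-1} (1 - u) ≲ F + 4 Δ ≤ 2 F`. So `u` is bounded
  below, `Δ` is negligible against `F`, and the same test yields `u ≥ 0.6`. The first-order condition
  in this direction says `F ≈ u^{n-1}`, and together with `F ≲ u^n + (1 - u)^n` this forces `u` to be
  close to `1` (`one_sub_lt_of_tests`, `IsSmallSystem.exists_lt_sq_inner`).

* *Uniqueness.* In the cap where `⟨a_i, x⟩²` is close to `1` the Riemannian Hessian is at most `-n`
  (`IsSmallSystem.sphereHess_le_neg`). Spherical caps are geodesically convex, so a critical point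
  `x` in a cap satisfies `f y ≤ f x - (n / 2) ‖x - y‖²` for all `y` in the cap
  (`le_sub_of_sphereHess_le`): it is unique and a strict local maximizer. As the noisy objective is
  at least `1 - Δ` at `± a_i` and at most `1` everywhere, taking `y = ± a_i` gives
  `‖x ∓ a_i‖² ≤ 2 Δ / n`. A maximizer over the cap is interior, so each of the `2 K` caps does
  contain a critical point.

The derivatives of `x ↦ x^{⊗ n}` enter only through the identity `⟨x^{⊗ n}, y^{⊗ n}⟩ = ⟨x, y⟩^n`;
differentiating it in both arguments gives all inner products and norms that are needed. -/

namespace SPM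

/-! ### Calculus of tensor powers -/

theorem inner_tensorPow (n : ℕ) {D : ℕ} (x y : Vec D) :
    inner ℝ (tensorPow n x) (tensorPow n y) = inner ℝ x y ^ n := by
  simp only [PiLp.inner_apply, tensorPow, RCLike.inner_apply, conj_trivial]
  rw [← Fin.prod_const, Finset.prod_univ_sum]
  simp [Finset.prod_mul_distrib]

theorem norm_tensorPow (n : ℕ) {D : ℕ} (x : Vec D) : ‖tensorPow n x‖ = ‖x‖ ^ n := by
  have h := inner_tensorPow n x x
  rw [real_inner_self_eq_norm_sq, real_inner_self_eq_norm_sq, ← pow_mul, mul_comm, pow_mul] at h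
  exact (sq_eq_sq₀ (norm_nonneg _) (by positivity)).1 h

theorem contDiff_tensorPow (n D : ℕ) : ContDiff ℝ ⊤ (tensorPow n : Vec D → Tensor n D) := by
  rw [contDiff_euclidean]
  intro i
  simp only [tensorPow]
  exact contDiff_prod fun k _ => (contDiff_euclidean.1 contDiff_id) (i k)

/-- Derivative of a differentiable map along an affine line. -/
theorem hasDerivAt_comp_line {E G : Type*} [NormedAddCommGroup E] [NormedSpace ℝ E]
    [NormedAddCommGroup G] [NormedSpace ℝ G] {f : E → G} (hf : Differentiable ℝ f) (x z : E)
    (t : ℝ) : HasDerivAt (fun t : ℝ => f (x + t • z)) (fderiv ℝ f (x + t • z) z) t := by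
  have h1 : HasDerivAt (fun t : ℝ => x + t • z) z t := by
    simpa using ((hasDerivAt_id t).smul_const z).const_add x
  exact (hf _).hasFDerivAt.comp_hasDerivAt t h1

/-- Second derivative of a `C²` map along an affine line. -/
theorem hasDerivAt_fderiv_comp_line {E G : Type*} [NormedAddCommGroup E] [NormedSpace ℝ E]
    [NormedAddCommGroup G] [NormedSpace ℝ G] {f : E → G} (hf : ContDiff ℝ 2 f) (x z : E)
    (t : ℝ) : HasDerivAt (fun t : ℝ => fderiv ℝ f (x + t • z) z)
      (fderiv ℝ (fderiv ℝ f) (x + t • z) z z) t := by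
  have h1 : Differentiable ℝ (fderiv ℝ f) :=
    (hf.fderiv_right (m := 1) (by norm_num)).differentiable (by norm_num)
  have h2 := (hasDerivAt_comp_line h1 x z t).clm_apply (hasDerivAt_const t z)
  simpa using h2

/-- The first derivative `D(x ↦ x^{⊗ n})(x)[z]`. -/
noncomputable def powDeriv (n : ℕ) {D : ℕ} (x z : Vec D) : Tensor n D :=
  fderiv ℝ (tensorPow n) x z

/-- The second derivative `D²(x ↦ x^{⊗ n})(x)[z, z]`. -/
noncomputable def powDeriv₂ (n : ℕ) {D : ℕ} (x z : Vec D) : Tensor n D :=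
  fderiv ℝ (fderiv ℝ (tensorPow n)) x z z

theorem hasDerivAt_tensorPow_line (n : ℕ) {D : ℕ} (x z : Vec D) (t : ℝ) :
    HasDerivAt (fun t : ℝ => tensorPow n (x + t • z)) (powDeriv n (x + t • z) z) t :=
  hasDerivAt_comp_line ((contDiff_tensorPow n D).differentiable (by simp)) x z t

theorem hasDerivAt_powDeriv_line (n : ℕ) {D : ℕ} (x z : Vec D) (t : ℝ) :
    HasDerivAt (fun t : ℝ => powDeriv n (x + t • z) z) (powDeriv₂ n (x + t • z) z) t :=
  hasDerivAt_fderiv_comp_line ((contDiff_tensorPow n D).of_le le_top) x z t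

theorem hasDerivAt_inner_line {D : ℕ} (x z y : Vec D) (t : ℝ) :
    HasDerivAt (fun t : ℝ => inner ℝ (x + t • z) y) (inner ℝ z y) t := by
  simp only [inner_add_left, inner_smul_left, conj_trivial]
  simpa using ((hasDerivAt_id t).mul_const (inner ℝ z y : ℝ)).const_add (inner ℝ x y : ℝ)

theorem inner_powDeriv (n : ℕ) {D : ℕ} (x z y : Vec D) :
    inner ℝ (powDeriv n x z) (tensorPow n y)
      = n * inner ℝ x y ^ (n - 1) * inner ℝ z y := by
  have h1 := (hasDerivAt_tensorPow_line n x z 0).inner ℝ (hasDerivAt_const (0 : ℝ) (tensorPow n y))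
  have h2 := (hasDerivAt_inner_line x z y 0).pow n
  simp only [inner_tensorPow] at h1
  simpa using h1.unique h2

theorem inner_powDeriv₂ (n : ℕ) (hn : 2 ≤ n) {D : ℕ} (x z y : Vec D) :
    inner ℝ (powDeriv₂ n x z) (tensorPow n y)
      = n * (n - 1) * inner ℝ x y ^ (n - 2) * inner ℝ z y ^ 2 := by
  have h1 := (hasDerivAt_powDeriv_line n x z 0).inner ℝ (hasDerivAt_const (0 : ℝ) (tensorPow n y))
  have h2 := (((hasDerivAt_inner_line x z y 0).pow (n - 1)).const_mul (n : ℝ)).mul_const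
    (inner ℝ z y : ℝ)
  simp only [inner_powDeriv] at h1
  have h3 := h1.unique h2
  have e : ((n - 1 : ℕ) : ℝ) = n - 1 := by push_cast [show 1 ≤ n by omega]; ring
  simp only [zero_smul, add_zero, inner_zero_right, zero_add, e, Nat.sub_sub] at h3
  rw [h3]; ring

/-- Euler's identity for the homogeneous map `x ↦ x^{⊗ n}`. -/
theorem powDeriv_self (n : ℕ) {D : ℕ} (x : Vec D) :
    powDeriv n x x = (n : ℝ) • tensorPow n x := by
  have h1 := hasDerivAt_tensorPow_line n x x 0
  have e : (fun t : ℝ => tensorPow n (x + t • x)) = fun t : ℝ => (1 + t) ^ n • tensorPow n x := by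
    funext t
    ext i
    simp only [tensorPow, PiLp.add_apply, PiLp.smul_apply, smul_eq_mul, ← one_add_mul,
      Finset.prod_mul_distrib, Finset.prod_const, Finset.card_univ, Fintype.card_fin]
  rw [e] at h1
  have h2 := (((hasDerivAt_id (0 : ℝ)).const_add 1).pow n).smul_const (tensorPow n x)
  simpa using h1.unique h2

theorem norm_powDeriv_sq (n : ℕ) {D : ℕ} {x z : Vec D} (hx : ‖x‖ = 1)
    (hxz : inner ℝ x z = 0) : ‖powDeriv n x z‖ ^ 2 = n * ‖z‖ ^ 2 := by
  have h1 := (hasDerivAt_const (0 : ℝ) (powDeriv n x z)).inner ℝ (hasDerivAt_tensorPow_line n x z 0)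
  simp only [inner_powDeriv] at h1
  have g : ∀ w : Vec D, HasDerivAt (fun t : ℝ => inner ℝ w (x + t • z)) (inner ℝ w z) 0 := by
    intro w
    simpa [real_inner_comm] using hasDerivAt_inner_line x z w 0
  have h2 := (((g x).pow (n - 1)).const_mul (n : ℝ)).mul (g z)
  have h3 := h1.unique h2
  simp only [zero_smul, add_zero, inner_zero_left, hxz, real_inner_self_eq_norm_sq, hx,
    real_inner_comm x z] at h3
  simpa [hx] using h3

theorem norm_powDeriv₂_sq (n : ℕ) (hn : 2 ≤ n) {D : ℕ} {x z : Vec D} (hx : ‖x‖ = 1)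
    (hxz : inner ℝ x z = 0) : ‖powDeriv₂ n x z‖ ^ 2 = 2 * n * (n - 1) * ‖z‖ ^ 4 := by
  have hzx : inner ℝ z x = 0 := by rw [real_inner_comm]; exact hxz
  have hxx : inner ℝ x x = (1 : ℝ) := by rw [real_inner_self_eq_norm_sq, hx]; norm_num
  have key : ∀ t : ℝ, inner ℝ (powDeriv₂ n x z) (tensorPow n (x + t • z))
      = n * (n - 1) * ‖z‖ ^ 4 * t ^ 2 := by
    intro t
    rw [inner_powDeriv₂ n hn]
    simp only [inner_add_right, inner_smul_right, hxz, hzx, real_inner_self_eq_norm_sq, hx]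
    simp
    ring
  have h1 : ∀ t : ℝ, inner ℝ (powDeriv₂ n x z) (powDeriv n (x + t • z) z)
      = n * (n - 1) * ‖z‖ ^ 4 * (2 * t) := by
    intro t
    have h1 := (hasDerivAt_const t (powDeriv₂ n x z)).inner ℝ (hasDerivAt_tensorPow_line n x z t)
    simp only [key] at h1
    have h2 := (hasDerivAt_pow 2 t).const_mul ((n : ℝ) * (n - 1) * ‖z‖ ^ 4)
    simpa using h1.unique h2
  have h2 := (hasDerivAt_const (0 : ℝ) (powDeriv₂ n x z)).inner ℝ (hasDerivAt_powDeriv_line n x z 0)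
  simp only [h1] at h2
  have h3 := ((hasDerivAt_id (0 : ℝ)).const_mul 2).const_mul ((n : ℝ) * (n - 1) * ‖z‖ ^ 4)
  have h4 := h2.unique h3
  simp only [zero_smul, add_zero, inner_zero_left, real_inner_self_eq_norm_sq] at h4
  rw [h4]; ring

/-! ### Derivatives of the objective -/

variable {n D : ℕ}

theorem starProjection_starProjection (B : Submodule ℝ (Tensor n D)) (T : Tensor n D) :
    B.starProjection (B.starProjection T) = B.starProjection T :=
  Submodule.starProjection_eq_self_iff.2 (B.starProjection_apply_mem T)

theorem norm_starProjection_sq (B : Submodule ℝ (Tensor n D)) (T : Tensor n D) :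
    ‖B.starProjection T‖ ^ 2 = inner ℝ (B.starProjection T) T := by
  rw [← real_inner_self_eq_norm_sq, ← Submodule.inner_starProjection_left_eq_right,
    starProjection_starProjection]

theorem objective_eq_inner (B : Submodule ℝ (Tensor n D)) (x : Vec D) :
    objective B x = inner ℝ (B.starProjection (tensorPow n x)) (tensorPow n x) :=
  norm_starProjection_sq B _

theorem contDiff_objective (B : Submodule ℝ (Tensor n D)) : ContDiff ℝ ⊤ (objective B) :=
  (B.starProjection.contDiff.comp (contDiff_tensorPow n D)).norm_sq ℝ

theorem differentiable_objective (B : Submodule ℝ (Tensor n D)) :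
    Differentiable ℝ (objective B) := (contDiff_objective B).differentiable (by simp)

theorem fderiv_objective (B : Submodule ℝ (Tensor n D)) (x z : Vec D) :
    fderiv ℝ (objective B) x z
      = 2 * inner ℝ (B.starProjection (tensorPow n x)) (powDeriv n x z) := by
  have h0 := hasDerivAt_tensorPow_line n x z 0
  have h1 := (B.starProjection.hasFDerivAt.comp_hasDerivAt (0 : ℝ) h0).inner ℝ h0
  have h2 := hasDerivAt_comp_line (differentiable_objective B) x z 0
  simp only [objective_eq_inner] at h2
  have h3 := h2.unique h1
  simp only [zero_smul, add_zero, Function.comp] at h3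
  rw [show (fderiv ℝ (objective B) x) z = _ from h3,
    Submodule.inner_starProjection_left_eq_right B (powDeriv n x z), real_inner_comm]
  ring

theorem fderiv_fderiv_objective (B : Submodule ℝ (Tensor n D)) (x z : Vec D) :
    fderiv ℝ (fderiv ℝ (objective B)) x z z
      = 2 * ‖B.starProjection (powDeriv n x z)‖ ^ 2
        + 2 * inner ℝ (B.starProjection (tensorPow n x)) (powDeriv₂ n x z) := by
  have h0 := hasDerivAt_tensorPow_line n x z 0
  have h1 := ((B.starProjection.hasFDerivAt.comp_hasDerivAt (0 : ℝ) h0).inner ℝ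
    (hasDerivAt_powDeriv_line n x z 0)).const_mul 2
  have h2 := hasDerivAt_fderiv_comp_line ((contDiff_objective B).of_le le_top) x z 0
  simp only [fderiv_objective] at h2
  have h3 := h2.unique h1
  simp only [zero_smul, add_zero, Function.comp] at h3
  rw [h3, norm_starProjection_sq]
  ring

theorem inner_gradient {f : Vec D → ℝ} (x z : Vec D) :
    inner ℝ (gradient f x) z = fderiv ℝ f x z := by
  simp [gradient]

theorem inner_gradient_objective_self (B : Submodule ℝ (Tensor n D)) (x : Vec D) :
    inner ℝ x (gradient (objective B) x) = 2 * n * objective B x := by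
  rw [real_inner_comm, inner_gradient, fderiv_objective, powDeriv_self, inner_smul_right,
    objective_eq_inner]
  ring

/-- On the sphere, the Riemannian gradient vanishes iff all tangential derivatives vanish. -/
theorem sphereGrad_eq_zero_iff {f : Vec D → ℝ} {x : Vec D} (hx : ‖x‖ = 1) :
    sphereGrad f x = 0 ↔ ∀ z, inner ℝ x z = 0 → fderiv ℝ f x z = 0 := by
  constructor
  · intro h z hz
    rw [sphereGrad, sub_eq_zero] at h
    rw [← inner_gradient, h, inner_smul_left, hz, mul_zero]
  · intro h
    have ht : inner ℝ x (sphereGrad f x) = 0 := by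
      rw [sphereGrad, inner_sub_right, inner_smul_right, real_inner_self_eq_norm_sq, hx]
      ring
    rw [← inner_self_eq_zero (𝕜 := ℝ)]
    conv_lhs => enter [2]; rw [sphereGrad]
    rw [inner_sub_left, inner_smul_left, ht, inner_gradient, h _ ht]
    simp

theorem sphereHess_objective (B : Submodule ℝ (Tensor n D)) (x z : Vec D) :
    sphereHess (objective B) x z
      = 2 * ‖B.starProjection (powDeriv n x z)‖ ^ 2
        + 2 * inner ℝ (B.starProjection (tensorPow n x)) (powDeriv₂ n x z)
        - 2 * n * objective B x * ‖z‖ ^ 2 := by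
  rw [sphereHess, fderiv_fderiv_objective, inner_gradient_objective_self]

theorem objective_neg (B : Submodule ℝ (Tensor n D)) (x : Vec D) :
    objective B (-x) = objective B x := by
  have e : tensorPow n (-x) = (-1 : ℝ) ^ n • tensorPow n x := by
    ext i
    simp [tensorPow, Finset.prod_neg]
  rw [objective, e, map_smul, norm_smul]
  simp [objective]

theorem objective_le_one (B : Submodule ℝ (Tensor n D)) {x : Vec D} (hx : ‖x‖ = 1) :
    objective B x ≤ 1 := by
  have h := B.norm_starProjection_apply_le (tensorPow n x)
  rw [norm_tensorPow, hx, one_pow] at h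
  exact pow_le_one₀ (norm_nonneg _) h

theorem objective_nonneg (B : Submodule ℝ (Tensor n D)) (x : Vec D) : 0 ≤ objective B x := by
  unfold objective; positivity

/-! ### Perturbation of the subspace -/

theorem subspaceError_nonneg (B B' : Submodule ℝ (Tensor n D)) : 0 ≤ subspaceError B B' :=
  norm_nonneg _

theorem abs_inner_starProjection_sub_le (B B' : Submodule ℝ (Tensor n D)) (S T : Tensor n D) :
    |inner ℝ (B.starProjection S) T - inner ℝ (B'.starProjection S) T|
      ≤ subspaceError B B' * ‖S‖ * ‖T‖ := by
  rw [← inner_sub_left, ← sub_apply]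
  refine (abs_real_inner_le_norm _ _).trans ?_
  gcongr
  exact ContinuousLinearMap.le_opNorm _ _

theorem abs_objective_sub_le (B B' : Submodule ℝ (Tensor n D)) {x : Vec D} (hx : ‖x‖ = 1) :
    |objective B x - objective B' x| ≤ subspaceError B B' := by
  have h := abs_inner_starProjection_sub_le B B' (tensorPow n x) (tensorPow n x)
  rw [← objective_eq_inner, ← objective_eq_inner, norm_tensorPow, hx] at h
  simpa using h

theorem abs_sphereHess_sub_le (hn : 2 ≤ n) (B B' : Submodule ℝ (Tensor n D)) {x z : Vec D}
    (hx : ‖x‖ = 1) (hxz : inner ℝ x z = 0) :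
    |sphereHess (objective B) x z - sphereHess (objective B') x z|
      ≤ 8 * n * subspaceError B B' * ‖z‖ ^ 2 := by
  have h1 := abs_inner_starProjection_sub_le B B' (powDeriv n x z) (powDeriv n x z)
  have h2 := abs_inner_starProjection_sub_le B B' (tensorPow n x) (powDeriv₂ n x z)
  have h3 := abs_objective_sub_le B B' hx
  have h0 := subspaceError_nonneg B B'
  have hM : ‖powDeriv₂ n x z‖ ≤ 2 * n * ‖z‖ ^ 2 := by
    refine le_of_sq_le_sq ?_ (by positivity)
    rw [norm_powDeriv₂_sq n hn hx hxz]
    nlinarith [mul_nonneg (show (0 : ℝ) ≤ n by positivity) (show 0 ≤ ‖z‖ ^ 4 by positivity),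
      mul_nonneg (show (0 : ℝ) ≤ n ^ 2 by positivity) (show 0 ≤ ‖z‖ ^ 4 by positivity)]
  rw [mul_assoc, ← sq, norm_powDeriv_sq n hx hxz, ← norm_starProjection_sq,
    ← norm_starProjection_sq] at h1
  rw [norm_tensorPow, hx, one_pow, mul_one] at h2
  have h3' : |2 * n * objective B x * ‖z‖ ^ 2 - 2 * n * objective B' x * ‖z‖ ^ 2|
      ≤ 2 * n * subspaceError B B' * ‖z‖ ^ 2 := by
    rw [← sub_mul, ← mul_sub, abs_mul, abs_mul, abs_of_nonneg (show (0 : ℝ) ≤ 2 * n by positivity),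
      abs_of_nonneg (show 0 ≤ ‖z‖ ^ 2 by positivity)]
    gcongr
  rw [sphereHess_objective, sphereHess_objective]
  rw [abs_le] at *
  constructor <;> nlinarith

end SPM

namespace SPM

/-! ### Geodesics on the sphere -/

/-- A function with `h'' ≤ -c` and `h' 0 = 0` lies below the parabola `h 0 - c t² / 2`. -/
theorem le_sub_of_second_deriv_le {h h' h'' : ℝ → ℝ} {c θ : ℝ} (hθ : 0 ≤ θ)
    (hd : ∀ t, HasDerivAt h (h' t) t) (hd' : ∀ t, HasDerivAt h' (h'' t) t) (h0 : h' 0 = 0)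
    (hc : ∀ t ∈ Set.Icc 0 θ, h'' t ≤ -c) : h θ ≤ h 0 - c / 2 * θ ^ 2 := by
  have hk' : AntitoneOn (fun t => h' t + c * t) (Set.Icc 0 θ) := by
    have hd2 : ∀ t, HasDerivAt (fun t => h' t + c * t) (h'' t + c) t := fun t =>
      ((hd' t).add ((hasDerivAt_id t).const_mul c)).congr_deriv (by simp)
    refine antitoneOn_of_deriv_nonpos (convex_Icc _ _)
      (fun t _ => (hd2 t).continuousAt.continuousWithinAt)
      (fun t _ => (hd2 t).differentiableAt.differentiableWithinAt) fun t ht => ?_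
    rw [(hd2 t).deriv]
    linarith [hc t (interior_subset ht)]
  have hk : AntitoneOn (fun t => h t + c / 2 * t ^ 2) (Set.Icc 0 θ) := by
    have hd2 : ∀ t, HasDerivAt (fun t => h t + c / 2 * t ^ 2) (h' t + c * t) t := fun t =>
      ((hd t).add ((hasDerivAt_pow 2 t).const_mul (c / 2))).congr_deriv (by simp; ring)
    refine antitoneOn_of_deriv_nonpos (convex_Icc _ _)
      (fun t _ => (hd2 t).continuousAt.continuousWithinAt)
      (fun t _ => (hd2 t).differentiableAt.differentiableWithinAt) fun t ht => ?_
    rw [(hd2 t).deriv]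
    have h1 := interior_subset ht
    simpa [h0] using hk' ⟨le_rfl, hθ⟩ h1 h1.1
  have := hk ⟨le_rfl, hθ⟩ ⟨hθ, le_rfl⟩ hθ
  simp only at this
  linarith

/-- The unit-speed great circle through `x` with velocity `z`. -/
noncomputable def greatCircle {D : ℕ} (x z : Vec D) (t : ℝ) : Vec D :=
  Real.cos t • x + Real.sin t • z

variable {D : ℕ}

theorem hasDerivAt_greatCircle (x z : Vec D) (t : ℝ) :
    HasDerivAt (greatCircle x z) (greatCircle z (-x) t) t :=
  (((Real.hasDerivAt_cos t).smul_const x).add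
    ((Real.hasDerivAt_sin t).smul_const z)).congr_deriv (by simp [greatCircle, add_comm])

theorem norm_greatCircle {x z : Vec D} (hx : ‖x‖ = 1) (hz : ‖z‖ = 1) (hxz : inner ℝ x z = 0)
    (t : ℝ) : ‖greatCircle x z t‖ = 1 := by
  have hzx : inner ℝ z x = 0 := by rw [real_inner_comm]; exact hxz
  rw [← sq_eq_sq₀ (norm_nonneg _) zero_le_one, ← real_inner_self_eq_norm_sq, greatCircle]
  simp only [inner_add_left, inner_add_right, inner_smul_left, inner_smul_right, hxz, hzx,
    real_inner_self_eq_norm_sq, hx, hz, conj_trivial]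
  linarith [Real.sin_sq_add_cos_sq t]

theorem inner_greatCircle_velocity {x z : Vec D} (hx : ‖x‖ = 1) (hz : ‖z‖ = 1)
    (hxz : inner ℝ x z = 0) (t : ℝ) :
    inner ℝ (greatCircle x z t) (greatCircle z (-x) t) = 0 := by
  have hzx : inner ℝ z x = 0 := by rw [real_inner_comm]; exact hxz
  simp only [greatCircle, inner_add_left, inner_add_right, inner_smul_left, inner_smul_right,
    inner_neg_right, hxz, hzx, real_inner_self_eq_norm_sq, hx, hz, conj_trivial]
  ring

/-- The second derivative of `f` along a great circle is the Riemannian Hessian. -/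
theorem hasDerivAt_greatCircle_two {f : Vec D → ℝ} (hf : ContDiff ℝ 2 f) {x z : Vec D}
    (hx : ‖x‖ = 1) (hz : ‖z‖ = 1) (hxz : inner ℝ x z = 0) (t : ℝ) :
    HasDerivAt (fun t => fderiv ℝ f (greatCircle x z t) (greatCircle z (-x) t))
      (sphereHess f (greatCircle x z t) (greatCircle z (-x) t)) t := by
  have h1 : Differentiable ℝ (fderiv ℝ f) :=
    (hf.fderiv_right (m := 1) (by norm_num)).differentiable (by norm_num)
  have h2 := ((h1 _).hasFDerivAt.comp_hasDerivAt t (hasDerivAt_greatCircle x z t)).clm_apply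
    (hasDerivAt_greatCircle z (-x) t)
  refine h2.congr_deriv ?_
  have e : greatCircle (-x) (-z) t = -greatCircle x z t := by
    simp [greatCircle]; abel
  rw [sphereHess, e, map_neg, norm_greatCircle hz (by simpa using hx)
    (by rw [inner_neg_right, real_inner_comm, hxz, neg_zero]), real_inner_comm, inner_gradient]
  simp [sub_eq_add_neg]

/-- The part of the sphere at height at least `h` in the direction `b`. -/
def sphereCap (b : Vec D) (h : ℝ) : Set (Vec D) := {x | ‖x‖ = 1 ∧ h ≤ inner ℝ x b}

/-- If the Riemannian Hessian is at most `-c` on a cap smaller than a hemisphere, a critical point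
in the cap is the maximizer over the cap, with quadratic decay: caps are geodesically convex, so the
second-order expansion along the great circle to any other point of the cap applies. -/
theorem le_sub_of_sphereHess_le {f : Vec D → ℝ} (hf : ContDiff ℝ 2 f) {b : Vec D} {h c : ℝ}
    (hh : 0 < h) (hc : 0 ≤ c)
    (hess : ∀ x ∈ sphereCap b h, ∀ z, inner ℝ x z = 0 → sphereHess f x z ≤ -c * ‖z‖ ^ 2)
    {x y : Vec D} (hx : x ∈ sphereCap b h) (hy : y ∈ sphereCap b h) (hg : sphereGrad f x = 0) :
    f y ≤ f x - c / 2 * ‖x - y‖ ^ 2 := by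
  obtain ⟨hx1, hxb⟩ := hx
  obtain ⟨hy1, hyb⟩ := hy
  set κ : ℝ := inner ℝ x y with hκ
  have hκ1 : κ ≤ 1 := by simpa [hx1, hy1] using real_inner_le_norm x y
  have hκ2 : -1 ≤ κ := by
    have := (abs_le.1 (abs_real_inner_le_norm x y)).1
    simpa [hx1, hy1] using this
  have hxy : ‖x - y‖ ^ 2 = 2 - 2 * κ := by
    rw [norm_sub_sq_real, hx1, hy1]; ring
  set w := y - κ • x with hw
  have hxw : inner ℝ x w = 0 := by
    rw [hw, inner_sub_right, inner_smul_right, real_inner_self_eq_norm_sq, hx1]; simp [hκ]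
  have hw2 : ‖w‖ ^ 2 = 1 - κ ^ 2 := by
    rw [hw, norm_sub_sq_real, inner_smul_right, norm_smul, hx1, hy1, real_inner_comm,
      Real.norm_eq_abs, mul_one, sq_abs]
    ring
  rcases eq_or_ne w 0 with hw0 | hw0
  · have e : y = κ • x := by rwa [hw, sub_eq_zero] at hw0
    have hκs : κ ^ 2 = 1 := by rw [hw0] at hw2; simp at hw2; linarith
    have hpos : 0 < κ := by
      by_contra hcon
      rw [e, inner_smul_left] at hyb
      simp only [conj_trivial] at hyb
      nlinarith
    have hκ' : κ = 1 := by nlinarith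
    rw [hxy, e, hκ']; simp
  have hwn : 0 < ‖w‖ := norm_pos_iff.2 hw0
  set z := ‖w‖⁻¹ • w with hzdef
  have hz1 : ‖z‖ = 1 := by
    rw [hzdef, norm_smul, norm_inv, norm_norm]; exact inv_mul_cancel₀ hwn.ne'
  have hxz : inner ℝ x z = 0 := by rw [hzdef, inner_smul_right, hxw, mul_zero]
  set θ := Real.arccos κ with hθ
  have hcos : Real.cos θ = κ := Real.cos_arccos hκ2 hκ1
  have hθ0 : 0 ≤ θ := Real.arccos_nonneg _
  have hθπ : θ ≤ Real.pi := Real.arccos_le_pi _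
  have hsin : Real.sin θ = ‖w‖ := by
    rw [hθ, Real.sin_arccos, ← hw2, Real.sqrt_sq hwn.le]
  have hyγ : greatCircle x z θ = y := by
    rw [greatCircle, hcos, hsin, hzdef, smul_smul, mul_inv_cancel₀ hwn.ne', hw]
    simp
  have hx0 : greatCircle x z 0 = x := by simp [greatCircle]
  have hcap : ∀ t ∈ Set.Icc 0 θ, greatCircle x z t ∈ sphereCap b h := by
    intro t ht
    refine ⟨norm_greatCircle hx1 hz1 hxz t, ?_⟩
    have hsθ : 0 < Real.sin θ := by rw [hsin]; exact hwn
    have hs1 : 0 ≤ Real.sin t := Real.sin_nonneg_of_nonneg_of_le_pi ht.1 (ht.2.trans hθπ)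
    have hs2 : 0 ≤ Real.sin (θ - t) :=
      Real.sin_nonneg_of_nonneg_of_le_pi (by linarith [ht.2]) (by linarith [ht.1])
    -- concavity of the sine, in the form `sin (θ - t) + sin t ≥ sin θ`
    have hs3 : Real.sin θ ≤ Real.sin (θ - t) + Real.sin t := by
      have e1 : Real.sin (θ - t) + Real.sin t - Real.sin θ
          = Real.sin t * (1 - Real.cos (θ - t)) + Real.sin (θ - t) * (1 - Real.cos t) := by
        have : Real.sin θ = Real.sin ((θ - t) + t) := by ring_nf
        rw [this, Real.sin_add]; ring
      have := mul_nonneg hs1 (sub_nonneg.2 (Real.cos_le_one (θ - t)))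
      have := mul_nonneg hs2 (sub_nonneg.2 (Real.cos_le_one t))
      linarith
    have e2 : Real.sin θ * inner ℝ (greatCircle x z t) b
        = Real.sin (θ - t) * inner ℝ x b + Real.sin t * inner ℝ y b := by
      rw [← hyγ]
      simp only [greatCircle, inner_add_left, inner_smul_left, Real.sin_sub, conj_trivial]
      ring
    have e3 : Real.sin θ * h ≤ Real.sin θ * inner ℝ (greatCircle x z t) b := by
      rw [e2]
      nlinarith [mul_le_mul_of_nonneg_left hxb hs2, mul_le_mul_of_nonneg_left hyb hs1]
    exact le_of_mul_le_mul_left e3 hsθ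
  have key := le_sub_of_second_deriv_le (h := fun t => f (greatCircle x z t)) (c := c) hθ0
    (fun t => ((hf.differentiable (by norm_num)) _).hasFDerivAt.comp_hasDerivAt t
      (hasDerivAt_greatCircle x z t))
    (fun t => hasDerivAt_greatCircle_two hf hx1 hz1 hxz t)
    (by simpa [greatCircle] using (sphereGrad_eq_zero_iff hx1).1 hg z hxz)
    (fun t ht => by
      have := hess _ (hcap t ht) _ (inner_greatCircle_velocity hx1 hz1 hxz t)
      rwa [norm_greatCircle hz1 (by simpa using hx1)
        (by rw [inner_neg_right, real_inner_comm, hxz, neg_zero]), one_pow, mul_one] at this)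
  simp only [hx0, hyγ] at key
  have hle : ‖x - y‖ ^ 2 ≤ θ ^ 2 := by
    have := Real.one_sub_sq_div_two_le_cos (x := θ)
    rw [hxy]; linarith
  nlinarith

/-- A point of the sphere that maximizes `f` over a neighbourhood in the sphere is critical. -/
theorem sphereGrad_eq_zero_of_eventually_le {f : Vec D → ℝ} (hf : Differentiable ℝ f) {x : Vec D}
    (hx : ‖x‖ = 1) (hmax : ∀ᶠ y in 𝓝 x, ‖y‖ = 1 → f y ≤ f x) : sphereGrad f x = 0 := by
  have unit : ∀ z : Vec D, ‖z‖ = 1 → inner ℝ x z = 0 → fderiv ℝ f x z = 0 := by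
    intro z hz hxz
    have hd := (hf _).hasFDerivAt.comp_hasDerivAt (0 : ℝ) (hasDerivAt_greatCircle x z 0)
    have hx0 : greatCircle x z 0 = x := by simp [greatCircle]
    have hz0 : greatCircle z (-x) 0 = z := by simp [greatCircle]
    have hloc : IsLocalMax (f ∘ greatCircle x z) 0 := by
      have hc : Tendsto (greatCircle x z) (𝓝 0) (𝓝 x) := by
        simpa [hx0] using (hasDerivAt_greatCircle x z 0).continuousAt.tendsto
      filter_upwards [hc.eventually hmax] with t ht
      simpa [hx0] using ht (norm_greatCircle hx hz hxz t)
    simpa [hx0, hz0] using hloc.hasDerivAt_eq_zero hd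
  refine (sphereGrad_eq_zero_iff hx).2 fun z hz => ?_
  rcases eq_or_ne z 0 with rfl | h0
  · simp
  · have hn : ‖z‖ ≠ 0 := norm_ne_zero_iff.2 h0
    have h1 := unit (‖z‖⁻¹ • z) (by rw [norm_smul, norm_inv, norm_norm, inv_mul_cancel₀ hn])
      (by rw [inner_smul_right, hz, mul_zero])
    rw [map_smul, smul_eq_mul] at h1
    exact (mul_eq_zero.1 h1).resolve_left (inv_ne_zero hn)

end SPM

namespace SPM

/-! ### Consequences of the matrix assumptions -/

theorem inner_toEuclideanCLM_le {p : ℕ} (M : Matrix (Fin p) (Fin p) ℝ)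
    (v w : EuclideanSpace ℝ (Fin p)) :
    inner ℝ v (Matrix.toEuclideanCLM (𝕜 := ℝ) M w) ≤ specNorm M * ‖v‖ * ‖w‖ := by
  refine (real_inner_le_norm _ _).trans ?_
  have := (Matrix.toEuclideanCLM (𝕜 := ℝ) M).le_opNorm w
  calc ‖v‖ * ‖Matrix.toEuclideanCLM (𝕜 := ℝ) M w‖ ≤ ‖v‖ * (specNorm M * ‖w‖) := by
        gcongr; exact this
    _ = _ := by ring

/-- The upper restricted isometry bound for at most `p` columns, in its dual (Bessel) form. -/
theorem sum_inner_sq_le_of_isRIP {D K p : ℕ} {a : Fin K → Vec D} {δ : ℝ}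
    (h : IsRIP (colMatrix a) p δ) {S : Finset (Fin K)} (hS : S.card ≤ p) (y : Vec D) :
    ∑ j ∈ S, inner ℝ (a j) y ^ 2 ≤ (1 + δ) * ‖y‖ ^ 2 := by
  obtain ⟨-, hpK, hδ, -, hrip⟩ := h
  obtain ⟨S', hSS', hcard⟩ := Finset.exists_superset_card_eq hS (by simpa using hpK)
  refine (Finset.sum_le_sum_of_subset_of_nonneg hSS' fun _ _ _ => sq_nonneg _).trans ?_
  set e : Fin p ↪ Fin K := (S'.orderEmbOfFin hcard).toEmbedding with he
  have hsum : ∑ j ∈ S', inner ℝ (a j) y ^ 2 = ∑ k : Fin p, inner ℝ (a (e k)) y ^ 2 := by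
    have hmap : Finset.univ.map e = S' := by
      rw [he]; exact Finset.map_orderEmbOfFin_univ S' hcard
    rw [← hmap, Finset.sum_map]
  rw [hsum]
  set M := ((colMatrix a).submatrix id e).transpose * (colMatrix a).submatrix id e - 1 with hM
  set w : EuclideanSpace ℝ (Fin p) := WithLp.toLp 2 fun k => inner ℝ (a (e k)) y with hw
  have hw2 : ∑ k : Fin p, inner ℝ (a (e k)) y ^ 2 = ‖w‖ ^ 2 := by
    rw [EuclideanSpace.norm_sq_eq]; simp [hw]
  rw [hw2]
  set b : Vec D := ∑ k, w k • a (e k) with hb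
  have hMw : ∀ k, Matrix.toEuclideanCLM (𝕜 := ℝ) M w k = inner ℝ (a (e k)) b - w k := by
    intro k
    rw [Matrix.ofLp_toEuclideanCLM, hM, Matrix.sub_mulVec, Matrix.one_mulVec, Pi.sub_apply, hb,
      inner_sum]
    congr 1
    simp only [Matrix.mulVec, dotProduct, Matrix.mul_apply, Matrix.transpose_apply,
      Matrix.submatrix_apply, colMatrix, Matrix.of_apply, id, inner_smul_right,
      PiLp.inner_apply, RCLike.inner_apply, conj_trivial]
    refine Finset.sum_congr rfl fun l _ => ?_
    rw [mul_comm]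
    congr 1
    exact Finset.sum_congr rfl fun _ _ => mul_comm _ _
  have h1 : inner ℝ w (Matrix.toEuclideanCLM (𝕜 := ℝ) M w) = ‖b‖ ^ 2 - ‖w‖ ^ 2 := by
    rw [PiLp.inner_apply, ← real_inner_self_eq_norm_sq b]
    conv_rhs => enter [1, 2]; rw [hb]
    rw [sum_inner, EuclideanSpace.norm_sq_eq, ← Finset.sum_sub_distrib]
    refine Finset.sum_congr rfl fun k _ => ?_
    rw [hMw]
    simp only [RCLike.inner_apply, conj_trivial, inner_smul_left, Real.norm_eq_abs, sq_abs]
    ring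
  have h2 : ‖b‖ ^ 2 ≤ (1 + δ) * ‖w‖ ^ 2 := by
    have h3 := inner_toEuclideanCLM_le M w w
    have h4 : specNorm M * ‖w‖ * ‖w‖ ≤ δ * ‖w‖ * ‖w‖ := by gcongr; exact hrip e
    nlinarith
  have h5 : ‖w‖ ^ 2 = inner ℝ b y := by
    rw [EuclideanSpace.norm_sq_eq, hb, sum_inner]
    refine Finset.sum_congr rfl fun k _ => ?_
    rw [inner_smul_left]; simp [hw]; ring
  have h6 : ‖w‖ ^ 2 ≤ ‖b‖ * ‖y‖ := h5 ▸ real_inner_le_norm b y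
  rcases eq_or_lt_of_le (norm_nonneg w) with h0 | h0
  · rw [← h0]; simp; positivity
  · have h7 : (‖w‖ ^ 2) * ‖w‖ ^ 2 ≤ ((1 + δ) * ‖y‖ ^ 2) * ‖w‖ ^ 2 := by
      calc (‖w‖ ^ 2) * ‖w‖ ^ 2 = (‖w‖ ^ 2) ^ 2 := by ring
        _ ≤ (‖b‖ * ‖y‖) ^ 2 := by gcongr
        _ = ‖b‖ ^ 2 * ‖y‖ ^ 2 := by ring
        _ ≤ ((1 + δ) * ‖w‖ ^ 2) * ‖y‖ ^ 2 := by gcongr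
        _ = _ := by ring
    exact le_of_mul_le_mul_right h7 (by positivity)

/-- A bound on the inverse Grammian bounds the coefficients of an element of `powSpan` by its
norm. The dual vector `∑ τ_j a_j^{⊗ n}` with `τ = G⁻¹ σ` replaces the spectral theorem. -/
theorem sum_sq_le_of_assumptionGrammian {n D K : ℕ} {a : Fin K → Vec D} {c : ℝ}
    (h : AssumptionGrammian n a c) (σ : Fin K → ℝ) :
    ∑ j, σ j ^ 2 ≤ c * ‖∑ j, σ j • tensorPow n (a j)‖ ^ 2 := by
  obtain ⟨hdet, hc⟩ := h
  set T := ∑ j, σ j • tensorPow n (a j) with hT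
  set w : EuclideanSpace ℝ (Fin K) := WithLp.toLp 2 σ with hw
  set τ := Matrix.toEuclideanCLM (𝕜 := ℝ) (grammian n a)⁻¹ w with hτ
  have hw2 : ∑ j, σ j ^ 2 = ‖w‖ ^ 2 := by rw [EuclideanSpace.norm_sq_eq]; simp [hw]
  set U := ∑ j, τ j • tensorPow n (a j) with hU
  have hUk : ∀ k, inner ℝ (tensorPow n (a k)) U = σ k := by
    intro k
    have h1 : (grammian n a).mulVec ((grammian n a)⁻¹.mulVec σ) = σ := by
      rw [Matrix.mulVec_mulVec, Matrix.mul_nonsing_inv _ hdet, Matrix.one_mulVec]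
    have h2 : τ.ofLp = (grammian n a)⁻¹.mulVec σ := by rw [hτ, Matrix.ofLp_toEuclideanCLM]
    rw [← h2] at h1
    conv_rhs => rw [← h1]
    rw [hU, inner_sum]
    simp only [inner_smul_right, inner_tensorPow, Matrix.mulVec, dotProduct, grammian,
      Matrix.of_apply]
    exact Finset.sum_congr rfl fun _ _ => mul_comm _ _
  have hU2 : ‖U‖ ^ 2 ≤ c * ‖w‖ ^ 2 := by
    have h1 : ‖U‖ ^ 2 = inner ℝ w τ := by
      rw [← real_inner_self_eq_norm_sq]
      conv_lhs => enter [2]; rw [hU]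
      rw [sum_inner, PiLp.inner_apply]
      refine Finset.sum_congr rfl fun k _ => ?_
      rw [inner_smul_left, hUk]; simp [hw]
    have h2 := inner_toEuclideanCLM_le (grammian n a)⁻¹ w w
    rw [h1]
    refine h2.trans ?_
    rw [mul_assoc, ← sq]
    gcongr
  have hTU : ‖w‖ ^ 2 = inner ℝ T U := by
    rw [hT, sum_inner, ← hw2]
    refine Finset.sum_congr rfl fun k _ => ?_
    rw [inner_smul_left, hUk]; simp [sq]
  have h6 : ‖w‖ ^ 2 ≤ ‖T‖ * ‖U‖ := hTU ▸ real_inner_le_norm T U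
  rw [hw2]
  rcases eq_or_lt_of_le (norm_nonneg w) with h0 | h0
  · have hc0 : 0 ≤ c := (norm_nonneg _).trans hc
    rw [← h0]; simp; positivity
  · have h7 : (‖w‖ ^ 2) * ‖w‖ ^ 2 ≤ (c * ‖T‖ ^ 2) * ‖w‖ ^ 2 := by
      calc (‖w‖ ^ 2) * ‖w‖ ^ 2 = (‖w‖ ^ 2) ^ 2 := by ring
        _ ≤ (‖T‖ * ‖U‖) ^ 2 := by gcongr
        _ = ‖T‖ ^ 2 * ‖U‖ ^ 2 := by ring
        _ ≤ ‖T‖ ^ 2 * (c * ‖w‖ ^ 2) := by gcongr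
        _ = _ := by ring
    exact le_of_mul_le_mul_right h7 (by positivity)

end SPM

namespace SPM

/-! ### Incoherent systems and the coefficients of the projection -/

/-- Unit vectors `a_j` with squared correlations at most `β`, with the Bessel bound
`∑_{j ∈ S} ⟨a_j, y⟩² ≤ (1 + δ) ‖y‖²` for at most `p` indices, `p β ≥ 2`, and with coefficients in
`powSpan n a` controlled by the norm (the smallest eigenvalue of the Grammian is at least `1 / c`).
The one threshold `β` serves both as the bound on correlations and as the level below which the
squared correlation of `a_j` with a test vector is negligible. -/
structure IsIncoherentSystem (n : ℕ) {D K : ℕ} (a : Fin K → Vec D) (c β δ : ℝ) (p : ℕ) :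
    Prop where
  norm_eq : ∀ i, ‖a i‖ = 1
  corr : ∀ i j, i ≠ j → inner ℝ (a i) (a j) ^ 2 ≤ β
  gram : ∀ σ : Fin K → ℝ, ∑ j, σ j ^ 2 ≤ c * ‖∑ j, σ j • tensorPow n (a j)‖ ^ 2
  bessel : ∀ S : Finset (Fin K), S.card ≤ p → ∀ y : Vec D,
    ∑ j ∈ S, inner ℝ (a j) y ^ 2 ≤ (1 + δ) * ‖y‖ ^ 2
  le_mul : 2 ≤ p * β
  β_pos : 0 < β
  β_le : β ≤ 1
  δ_nonneg : 0 ≤ δ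
  δ_le : δ ≤ 1
  one_le : 1 ≤ c

/-- The indices of the components whose squared correlation with `y` exceeds `β`. -/
noncomputable def heavy {D K : ℕ} (a : Fin K → Vec D) (β : ℝ) (y : Vec D) : Finset (Fin K) :=
  Finset.univ.filter fun j => β < inner ℝ (a j) y ^ 2

/-- `σ` are the coefficients of the projection of `x^{⊗ n}` onto `powSpan n a`, and `q` bounds the
distance of `σ_j` from its value `⟨a_j, x⟩^n` in the orthonormal case, as well as the contribution
of negligible weights to sums against `σ`. -/
structure IsExpansion (n : ℕ) {D K : ℕ} (a : Fin K → Vec D) (c β : ℝ) (x : Vec D)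
    (σ : Fin K → ℝ) (q : ℝ) : Prop where
  proj : (powSpan n a).starProjection (tensorPow n x) = ∑ j, σ j • tensorPow n (a j)
  energy : ∑ j, σ j ^ 2 ≤ c * objective (powSpan n a) x
  q_nonneg : 0 ≤ q
  tail : ∀ (U : Finset (Fin K)) (w : Fin K → ℝ), (∀ j ∈ U, w j ^ 2 ≤ β ^ n) →
    |∑ j ∈ U, σ j * w j| ≤ q
  close : ∀ j, |σ j - inner ℝ (a j) x ^ n| ≤ q

variable {n D K p : ℕ} {a : Fin K → Vec D} {c β δ : ℝ}

theorem mem_powSpan (n : ℕ) (a : Fin K → Vec D) (i : Fin K) : tensorPow n (a i) ∈ powSpan n a :=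
  Submodule.subset_span ⟨i, rfl⟩

theorem inner_starProjection_powSpan (T : Tensor n D) (i : Fin K) :
    inner ℝ ((powSpan n a).starProjection T) (tensorPow n (a i))
      = inner ℝ T (tensorPow n (a i)) := by
  rw [Submodule.inner_starProjection_left_eq_right,
    Submodule.starProjection_eq_self_iff.2 (mem_powSpan n a i)]

theorem exists_starProjection_eq_sum (T : Tensor n D) :
    ∃ σ : Fin K → ℝ, (powSpan n a).starProjection T = ∑ j, σ j • tensorPow n (a j) := by
  obtain ⟨σ, hσ⟩ := (Submodule.mem_span_range_iff_exists_fun ℝ).1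
    ((powSpan n a).starProjection_apply_mem T)
  exact ⟨σ, hσ.symm⟩

theorem pow_le_sq_of_abs_le_one {y : ℝ} (hy : |y| ≤ 1) (hn : 2 ≤ n) : |y| ^ n ≤ y ^ 2 := by
  rw [← sq_abs]
  exact pow_le_pow_of_le_one (abs_nonneg _) hy hn

theorem sum_pow_le {ι : Type*} (S : Finset ι) (f : ι → ℝ) {m : ℝ} (hn : 1 ≤ n)
    (h0 : ∀ j ∈ S, 0 ≤ f j) (hm : ∀ j ∈ S, f j ≤ m) :
    ∑ j ∈ S, f j ^ n ≤ m ^ (n - 1) * ∑ j ∈ S, f j := by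
  rw [Finset.mul_sum]
  refine Finset.sum_le_sum fun j hj => ?_
  obtain ⟨k, rfl⟩ := Nat.exists_eq_add_of_le' hn
  rw [Nat.add_sub_cancel, pow_succ]
  exact mul_le_mul_of_nonneg_right (pow_le_pow_left₀ (h0 j hj) (hm j hj) k) (h0 j hj)

namespace IsIncoherentSystem

section
variable (hs : IsIncoherentSystem n a c β δ p)
include hs

theorem abs_inner_le (j : Fin K) {y : Vec D} (hy : ‖y‖ = 1) : |inner ℝ (a j) y| ≤ 1 := by
  simpa [hs.norm_eq j, hy] using abs_real_inner_le_norm (a j) y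

theorem inner_self_eq (j : Fin K) : inner ℝ (a j) (a j) = (1 : ℝ) := by
  rw [real_inner_self_eq_norm_sq, hs.norm_eq]; norm_num

theorem two_le : 2 ≤ p := by
  have h1 := hs.le_mul
  have h2 := mul_le_mul_of_nonneg_left hs.β_le (Nat.cast_nonneg (α := ℝ) p)
  rw [mul_one] at h2
  exact_mod_cast h1.trans h2

theorem card_heavy_le {y : Vec D} (hy : ‖y‖ = 1) : (heavy a β y).card ≤ p := by
  by_contra! hcon
  obtain ⟨S, hS, hcard⟩ := Finset.exists_subset_card_eq hcon.le
  have h1 := hs.bessel S hcard.le y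
  have h2 : ∑ _j ∈ S, β < ∑ j ∈ S, inner ℝ (a j) y ^ 2 := by
    refine Finset.sum_lt_sum_of_nonempty ?_ fun j hj => (Finset.mem_filter.1 (hS hj)).2
    rw [← Finset.card_pos, hcard]
    have := hs.two_le
    omega
  rw [Finset.sum_const, hcard, nsmul_eq_mul] at h2
  rw [hy] at h1
  linarith [hs.le_mul, hs.δ_le]

theorem sum_heavy_le {x : Vec D} (hx : ‖x‖ = 1) (y : Vec D) :
    ∑ j ∈ heavy a β x, inner ℝ (a j) y ^ 2 ≤ (1 + δ) * ‖y‖ ^ 2 :=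
  hs.bessel _ (hs.card_heavy_le hx) y

theorem sq_inner_add_sq_inner_le {i j : Fin K} (hij : j ≠ i) {y : Vec D} (hy : ‖y‖ = 1) :
    inner ℝ (a j) y ^ 2 + inner ℝ (a i) y ^ 2 ≤ 1 + δ := by
  have h := hs.bessel {j, i} ((Finset.card_pair hij).le.trans hs.two_le) y
  rwa [Finset.sum_pair hij, hy, one_pow, mul_one] at h

theorem objective_component (i : Fin K) : objective (powSpan n a) (a i) = 1 := by
  rw [objective, Submodule.starProjection_eq_self_iff.2 (mem_powSpan n a i), norm_tensorPow,
    hs.norm_eq]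
  simp

theorem sq_inner_le_norm_starProjection_sq (T : Tensor n D) (i : Fin K) :
    inner ℝ T (tensorPow n (a i)) ^ 2 ≤ ‖(powSpan n a).starProjection T‖ ^ 2 := by
  rw [← inner_starProjection_powSpan, sq_le_sq, abs_norm]
  have h := abs_real_inner_le_norm ((powSpan n a).starProjection T) (tensorPow n (a i))
  rwa [norm_tensorPow, hs.norm_eq, one_pow, mul_one] at h

theorem pow_le_objective (x : Vec D) (i : Fin K) :
    (inner ℝ (a i) x ^ 2) ^ n ≤ objective (powSpan n a) x := by
  have h := hs.sq_inner_le_norm_starProjection_sq (tensorPow n x) i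
  rw [inner_tensorPow, real_inner_comm] at h
  rwa [← pow_mul, mul_comm, pow_mul]

theorem norm_starProjection_sq_le (T : Tensor n D) :
    ‖(powSpan n a).starProjection T‖ ^ 2 ≤ c * ∑ j, inner ℝ T (tensorPow n (a j)) ^ 2 := by
  obtain ⟨σ, hσ⟩ := exists_starProjection_eq_sum (a := a) T
  have hg := hs.gram σ
  rw [← hσ] at hg
  set N := ‖(powSpan n a).starProjection T‖ ^ 2 with hN
  have h1 : N = ∑ j, σ j * inner ℝ T (tensorPow n (a j)) := by
    rw [hN, norm_starProjection_sq, hσ, sum_inner]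
    refine Finset.sum_congr rfl fun j _ => ?_
    rw [inner_smul_left, real_inner_comm]; simp
  have h2 : N ^ 2 ≤ (c * N) * ∑ j, inner ℝ T (tensorPow n (a j)) ^ 2 := by
    rw [h1]
    refine (Finset.sum_mul_sq_le_sq_mul_sq _ _ _).trans ?_
    rw [← h1]
    gcongr
  have hc := hs.one_le
  rcases eq_or_lt_of_le (show 0 ≤ N by positivity) with h0 | h0
  · rw [← h0]; positivity
  · refine le_of_mul_le_mul_left ?_ h0
    nlinarith

/-- The coefficients of the projection of `x^{⊗ n}` are close to their values in the orthonormal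
case. The fixed-point form `σ_j = ⟨a_j, x⟩^n - ∑_{k ≠ j} σ_k ⟨a_k, a_j⟩^n` of the Gram equation and
the Cauchy–Schwarz inequality give this, since the squares of the off-diagonal entries in a column
of the Grammian sum to at most `K β^n`. -/
theorem exists_isExpansion (x : Vec D) : ∃ σ, IsExpansion n a c β x σ
    (√(c * objective (powSpan n a) x * (K * β ^ n))) := by
  obtain ⟨σ, hσ⟩ := exists_starProjection_eq_sum (a := a) (tensorPow n x)
  have henergy : ∑ j, σ j ^ 2 ≤ c * objective (powSpan n a) x := by
    have := hs.gram σ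
    rwa [← hσ] at this
  have htail : ∀ (U : Finset (Fin K)) (w : Fin K → ℝ), (∀ j ∈ U, w j ^ 2 ≤ β ^ n) →
      |∑ j ∈ U, σ j * w j| ≤ √(c * objective (powSpan n a) x * (K * β ^ n)) := by
    intro U w hw
    refine Real.abs_le_sqrt ((Finset.sum_mul_sq_le_sq_mul_sq _ _ _).trans ?_)
    have hβ := hs.β_pos
    have h1 : ∑ j ∈ U, σ j ^ 2 ≤ c * objective (powSpan n a) x :=
      (Finset.sum_le_sum_of_subset_of_nonneg (Finset.subset_univ _)
        fun _ _ _ => sq_nonneg _).trans henergy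
    have h2 : ∑ j ∈ U, w j ^ 2 ≤ K * β ^ n := by
      refine (Finset.sum_le_card_nsmul _ _ _ hw).trans ?_
      rw [nsmul_eq_mul]
      gcongr
      simpa using Finset.card_le_univ U
    exact mul_le_mul h1 h2 (Finset.sum_nonneg fun _ _ => sq_nonneg _)
      ((Finset.sum_nonneg fun _ _ => sq_nonneg _).trans h1)
  refine ⟨σ, hσ, henergy, Real.sqrt_nonneg _, htail, fun j => ?_⟩
  have h1 : inner ℝ (a j) x ^ n = ∑ k, σ k * inner ℝ (a k) (a j) ^ n := by
    have h2 := inner_starProjection_powSpan (a := a) (tensorPow n x) j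
    rw [hσ, inner_tensorPow, sum_inner, real_inner_comm] at h2
    rw [← h2]
    refine Finset.sum_congr rfl fun k _ => ?_
    rw [inner_smul_left, inner_tensorPow]; simp
  rw [h1, ← Finset.add_sum_erase _ _ (Finset.mem_univ j), hs.inner_self_eq, one_pow, mul_one,
    sub_add_cancel_left, abs_neg]
  refine htail _ _ fun k hk => ?_
  rw [← pow_mul, mul_comm, pow_mul]
  exact pow_le_pow_left₀ (sq_nonneg _) (hs.corr _ _ (Finset.ne_of_mem_erase hk)) n

end

end IsIncoherentSystem

namespace IsExpansion

variable {x : Vec D} {σ : Fin K → ℝ} {q : ℝ}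

theorem inner_proj (he : IsExpansion n a c β x σ q) (T : Tensor n D) :
    inner ℝ ((powSpan n a).starProjection (tensorPow n x)) T
      = ∑ j, σ j * inner ℝ T (tensorPow n (a j)) := by
  rw [he.proj, sum_inner]
  refine Finset.sum_congr rfl fun j _ => ?_
  rw [inner_smul_left, real_inner_comm]; simp

theorem objective_eq (he : IsExpansion n a c β x σ q) :
    objective (powSpan n a) x = ∑ j, σ j * inner ℝ (a j) x ^ n := by
  rw [objective_eq_inner, he.inner_proj]
  simp only [inner_tensorPow, real_inner_comm]

theorem sum_sq_le (he : IsExpansion n a c β x σ q) (hs : IsIncoherentSystem n a c β δ p)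
    (hx : ‖x‖ = 1) : ∑ j, σ j ^ 2 ≤ c := by
  have h1 := objective_le_one (powSpan n a) hx
  have h2 := he.energy
  have h3 := hs.one_le
  nlinarith

/-! ### Bounds on the noiseless objective -/

theorem objective_le_sum_heavy (he : IsExpansion n a c β x σ q)
    (hs : IsIncoherentSystem n a c β δ p) (hn : 2 ≤ n) (hx : ‖x‖ = 1) :
    objective (powSpan n a) x ≤ ∑ j ∈ heavy a β x, (inner ℝ (a j) x ^ 2) ^ n + 3 * q := by
  rw [he.objective_eq, ← Finset.sum_add_sum_compl (heavy a β x)]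
  have h1 : ∑ j ∈ (heavy a β x)ᶜ, σ j * inner ℝ (a j) x ^ n ≤ q := by
    refine (le_abs_self _).trans (he.tail _ _ fun j hj => ?_)
    have hj' : inner ℝ (a j) x ^ 2 ≤ β := by
      simpa [heavy] using hj
    rw [← pow_mul, mul_comm, pow_mul]
    exact pow_le_pow_left₀ (sq_nonneg _) hj' n
  have h2 : ∑ j ∈ heavy a β x, σ j * inner ℝ (a j) x ^ n
      ≤ ∑ j ∈ heavy a β x, ((inner ℝ (a j) x ^ 2) ^ n + q * inner ℝ (a j) x ^ 2) := by
    refine Finset.sum_le_sum fun j _ => ?_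
    have h3 := pow_le_sq_of_abs_le_one (hs.abs_inner_le j hx) hn
    have h4 : (σ j - inner ℝ (a j) x ^ n) * inner ℝ (a j) x ^ n ≤ q * inner ℝ (a j) x ^ 2 := by
      refine (le_abs_self _).trans ?_
      rw [abs_mul, abs_pow]
      exact mul_le_mul (he.close j) h3 (by positivity) he.q_nonneg
    have h5 : (inner ℝ (a j) x ^ 2) ^ n = inner ℝ (a j) x ^ n * inner ℝ (a j) x ^ n := by
      rw [← pow_mul, ← pow_add, two_mul]
    rw [h5]; linarith
  rw [Finset.sum_add_distrib, ← Finset.mul_sum] at h2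
  have h6 := hs.sum_heavy_le hx x
  rw [hx] at h6
  have h7 := mul_le_mul_of_nonneg_left (h6.trans (show (1 + δ) * 1 ^ 2 ≤ 2 by linarith [hs.δ_le]))
    he.q_nonneg
  linarith

theorem objective_le_of_forall_le (he : IsExpansion n a c β x σ q)
    (hs : IsIncoherentSystem n a c β δ p) (hn : 2 ≤ n) (hx : ‖x‖ = 1) {m : ℝ} (hm0 : 0 ≤ m)
    (hm : ∀ j, inner ℝ (a j) x ^ 2 ≤ m) :
    objective (powSpan n a) x ≤ (1 + δ) * m ^ (n - 1) + 3 * q := by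
  have h1 := he.objective_le_sum_heavy hs hn hx
  have h2 := sum_pow_le (n := n) (heavy a β x) (fun j => inner ℝ (a j) x ^ 2) (by omega)
    (fun _ _ => sq_nonneg _) (fun j _ => hm j)
  have h3 := hs.sum_heavy_le hx x
  rw [hx] at h3
  have h4 := mul_le_mul_of_nonneg_left h3 (pow_nonneg hm0 (n - 1))
  linarith

theorem objective_le_of_heavy (he : IsExpansion n a c β x σ q)
    (hs : IsIncoherentSystem n a c β δ p) (hn : 2 ≤ n) (hx : ‖x‖ = 1) {i : Fin K}
    (hi : β < inner ℝ (a i) x ^ 2) :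
    objective (powSpan n a) x ≤ (inner ℝ (a i) x ^ 2) ^ n
      + (1 + δ - inner ℝ (a i) x ^ 2) ^ n + 3 * q := by
  have h1 := he.objective_le_sum_heavy hs hn hx
  have hi' : i ∈ heavy a β x := by simpa [heavy] using hi
  rw [← Finset.add_sum_erase _ _ hi'] at h1
  have h2 := sum_pow_le (n := n) ((heavy a β x).erase i) (fun j => inner ℝ (a j) x ^ 2)
    (m := 1 + δ - inner ℝ (a i) x ^ 2) (by omega)
    (fun _ _ => sq_nonneg _) (fun j hj => by
      have := hs.sq_inner_add_sq_inner_le (Finset.ne_of_mem_erase hj) hx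
      linarith)
  have h3 := hs.sum_heavy_le hx x
  rw [hx, ← Finset.add_sum_erase _ _ hi'] at h3
  have h0 : 0 ≤ 1 + δ - inner ℝ (a i) x ^ 2 := by
    have := (sq_le_one_iff_abs_le_one _).2 (hs.abs_inner_le i hx)
    linarith [hs.δ_nonneg]
  have h4 := mul_le_mul_of_nonneg_left
    (show ∑ j ∈ (heavy a β x).erase i, inner ℝ (a j) x ^ 2 ≤ 1 + δ - inner ℝ (a i) x ^ 2 by
      linarith) (pow_nonneg h0 (n - 1))
  rw [← pow_succ, Nat.sub_add_cancel (by omega : 1 ≤ n)] at h4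
  linarith

end IsExpansion

end SPM

namespace SPM

variable {n D K p : ℕ} {a : Fin K → Vec D} {c β δ : ℝ}

/-! ### Testing critical points in the direction of a component -/

/-- The tangential part at `x` of the component `a i`. -/
noncomputable def tangentPart (a : Fin K → Vec D) (i : Fin K) (x : Vec D) : Vec D :=
  a i - (inner ℝ (a i) x : ℝ) • x

theorem inner_self_tangentPart (a : Fin K → Vec D) (i : Fin K) {x : Vec D} (hx : ‖x‖ = 1) :
    inner ℝ x (tangentPart a i x) = 0 := by
  rw [tangentPart, inner_sub_right, inner_smul_right, real_inner_self_eq_norm_sq, hx,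
    real_inner_comm]
  ring

theorem inner_tangentPart (a : Fin K → Vec D) (i j : Fin K) (x : Vec D) :
    inner ℝ (a j) (tangentPart a i x)
      = inner ℝ (a j) (a i) - inner ℝ (a i) x * inner ℝ (a j) x := by
  rw [tangentPart, inner_sub_right, inner_smul_right]

variable {x : Vec D} {σ : Fin K → ℝ} {q : ℝ}

namespace IsIncoherentSystem

section
variable (hs : IsIncoherentSystem n a c β δ p)
include hs

theorem norm_tangentPart_sq (i : Fin K) (hx : ‖x‖ = 1) :
    ‖tangentPart a i x‖ ^ 2 = 1 - inner ℝ (a i) x ^ 2 := by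
  rw [tangentPart, norm_sub_sq_real, inner_smul_right, norm_smul, hx, hs.norm_eq,
    Real.norm_eq_abs, mul_one, sq_abs]
  ring

end

end IsIncoherentSystem

namespace IsExpansion

theorem le_sum_hess_test (he : IsExpansion n a c β x σ q)
    (hs : IsIncoherentSystem n a c β δ p) (hn : 2 ≤ n) (hx : ‖x‖ = 1) (i : Fin K) :
    (inner ℝ (a i) x ^ 2) ^ (n - 1) * (1 - inner ℝ (a i) x ^ 2) ^ 2 - 7 * q
      ≤ ∑ j, σ j * (inner ℝ (a j) x ^ (n - 2) * inner ℝ (a j) (tangentPart a i x) ^ 2) := by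
  set ζ : Fin K → ℝ := fun j => inner ℝ (a j) x with hζ
  set g : Fin K → ℝ := fun j => inner ℝ (a j) (tangentPart a i x) with hg
  change (ζ i ^ 2) ^ (n - 1) * (1 - ζ i ^ 2) ^ 2 - 7 * q
      ≤ ∑ j, σ j * (ζ j ^ (n - 2) * g j ^ 2)
  have hgi : g i = 1 - ζ i ^ 2 := by
    simp only [hg, inner_tangentPart, hs.inner_self_eq]; ring
  have hζ1 : ∀ j, |ζ j| ≤ 1 := fun j => hs.abs_inner_le j hx
  have hζi : ζ i ^ 2 ≤ 1 := (sq_le_one_iff_abs_le_one _).2 (hζ1 i)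
  set T := insert i (heavy a β x) with hT
  rw [← Finset.sum_add_sum_compl T]
  have hq := he.q_nonneg
  have hβ := hs.β_pos
  have h1 : -(4 * q) ≤ ∑ j ∈ Tᶜ, σ j * (ζ j ^ (n - 2) * g j ^ 2) := by
    have h2 : |∑ j ∈ Tᶜ, σ j * (ζ j ^ (n - 2) * g j ^ 2 / 4)| ≤ q := by
      refine he.tail _ _ fun j hj => ?_
      simp only [hT, Finset.mem_compl, Finset.mem_insert, not_or, heavy, Finset.mem_filter,
        Finset.mem_univ, true_and, not_lt] at hj
      have h3 : ζ j ^ 2 ≤ β := hj.2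
      have h4 : g j ^ 2 ≤ 4 * β := by
        have h5 := hs.corr j i hj.1
        have h6 : (ζ i * ζ j) ^ 2 ≤ β := by
          rw [mul_pow]
          nlinarith [sq_nonneg (ζ j), sq_nonneg (ζ i)]
        simp only [hg, inner_tangentPart]
        change (inner ℝ (a j) (a i) - ζ i * ζ j) ^ 2 ≤ 4 * β
        nlinarith [sq_nonneg (inner ℝ (a j) (a i) + ζ i * ζ j)]
      have h7 : (ζ j ^ (n - 2) * g j ^ 2 / 4) ^ 2 = (ζ j ^ 2) ^ (n - 2) * (g j ^ 2 / 4) ^ 2 := by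
        ring
      have h8 : β ^ n = β ^ (n - 2) * β ^ 2 := by rw [← pow_add, Nat.sub_add_cancel hn]
      rw [h7, h8]
      gcongr
      linarith
    have h3 := (abs_le.1 h2).1
    have h4 : ∑ j ∈ Tᶜ, σ j * (ζ j ^ (n - 2) * g j ^ 2)
        = 4 * ∑ j ∈ Tᶜ, σ j * (ζ j ^ (n - 2) * g j ^ 2 / 4) := by
      rw [Finset.mul_sum]
      exact Finset.sum_congr rfl fun _ _ => by ring
    rw [h4]; linarith
  have hterm : ∀ j, (ζ j ^ 2) ^ (n - 1) * g j ^ 2 - q * g j ^ 2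
      ≤ σ j * (ζ j ^ (n - 2) * g j ^ 2) := by
    intro j
    have e : (ζ j ^ 2) ^ (n - 1) = ζ j ^ n * ζ j ^ (n - 2) := by
      rw [← pow_mul, ← pow_add]; congr 1; omega
    have h3 : |(σ j - ζ j ^ n) * ζ j ^ (n - 2)| ≤ q := by
      rw [abs_mul, abs_pow]
      exact (mul_le_mul (he.close j) (pow_le_one₀ (abs_nonneg _) (hζ1 j)) (by positivity)
        hq).trans_eq (mul_one q)
    have h4 := mul_le_mul_of_nonneg_right (abs_le.1 h3).1 (sq_nonneg (g j))
    rw [e]; nlinarith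
  have hiT : i ∈ T := Finset.mem_insert_self _ _
  have h5 : ∑ j ∈ T, g j ^ 2 ≤ 3 := by
    have h6 : ∑ j ∈ T, g j ^ 2 ≤ g i ^ 2 + ∑ j ∈ heavy a β x, g j ^ 2 := by
      rw [hT]
      by_cases hmem : i ∈ heavy a β x
      · rw [Finset.insert_eq_of_mem hmem]; linarith [sq_nonneg (g i)]
      · rw [Finset.sum_insert hmem]
    have h7 := hs.sum_heavy_le hx (tangentPart a i x)
    rw [hs.norm_tangentPart_sq i hx] at h7
    have h8 : (1 + δ) * (1 - ζ i ^ 2) ≤ 2 * 1 := by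
      have := hs.δ_le
      have := hs.δ_nonneg
      apply mul_le_mul <;> nlinarith [sq_nonneg (ζ i)]
    have h9 : g i ^ 2 ≤ 1 := by
      rw [hgi]; nlinarith [sq_nonneg (ζ i)]
    linarith [show ∑ j ∈ heavy a β x, g j ^ 2 ≤ (1 + δ) * (1 - ζ i ^ 2) from h7]
  have h6 : (ζ i ^ 2) ^ (n - 1) * g i ^ 2 - q * ∑ j ∈ T, g j ^ 2
      ≤ ∑ j ∈ T, σ j * (ζ j ^ (n - 2) * g j ^ 2) := by
    refine le_trans ?_ (Finset.sum_le_sum fun j _ => hterm j)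
    rw [Finset.sum_sub_distrib, ← Finset.mul_sum]
    gcongr
    exact Finset.single_le_sum (f := fun j => (ζ j ^ 2) ^ (n - 1) * g j ^ 2)
      (fun j _ => by positivity) hiT
  have h7 := mul_le_mul_of_nonneg_left h5 hq
  rw [hgi] at h6
  linarith

/-- The second-order condition in the direction of `a i`. -/
theorem second_order_test (he : IsExpansion n a c β x σ q)
    (hs : IsIncoherentSystem n a c β δ p) (hn : 2 ≤ n) {B : Submodule ℝ (Tensor n D)}
    (hcrit : IsSecondOrderCritical (objective B) x) (i : Fin K) :
    (2 * n - 1) * ((inner ℝ (a i) x ^ 2) ^ (n - 1) * (1 - inner ℝ (a i) x ^ 2) ^ 2)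
      ≤ (objective (powSpan n a) x + 4 * subspaceError (powSpan n a) B)
        * (1 - inner ℝ (a i) x ^ 2) + 7 * (n - 1) * q := by
  have hx : ‖x‖ = 1 := by simpa [unitSphere] using hcrit.1
  have hw := inner_self_tangentPart a i hx
  have h1 := hcrit.2.2 _ hw
  have h2 := (abs_le.1 (abs_sphereHess_sub_le hn (powSpan n a) B hx hw)).2
  rw [sphereHess_objective (powSpan n a)] at h2
  rw [hs.norm_tangentPart_sq i hx] at h2
  have h3 := hs.sq_inner_le_norm_starProjection_sq (powDeriv n x (tangentPart a i x)) i
  rw [inner_powDeriv, real_inner_comm (a i) (tangentPart a i x), inner_tangentPart,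
    hs.inner_self_eq, real_inner_comm] at h3
  have h4 := he.le_sum_hess_test hs hn hx i
  have h5 : inner ℝ ((powSpan n a).starProjection (tensorPow n x))
      (powDeriv₂ n x (tangentPart a i x)) = n * (n - 1) *
      ∑ j, σ j * (inner ℝ (a j) x ^ (n - 2) * inner ℝ (a j) (tangentPart a i x) ^ 2) := by
    rw [he.inner_proj, Finset.mul_sum]
    refine Finset.sum_congr rfl fun j _ => ?_
    rw [inner_powDeriv₂ n hn, real_inner_comm, real_inner_comm (a j)]
    ring
  rw [h5] at h2
  set u : ℝ := inner ℝ (a i) x ^ 2 with hu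
  set S := ∑ j, σ j * (inner ℝ (a j) x ^ (n - 2) * inner ℝ (a j) (tangentPart a i x) ^ 2)
  have e : ((n : ℝ) * inner ℝ (a i) x ^ (n - 1) * (1 - inner ℝ (a i) x * inner ℝ (a i) x)) ^ 2
      = n * (n * (u ^ (n - 1) * (1 - u) ^ 2)) := by
    rw [hu]; ring
  rw [e] at h3
  have hn0 : (0 : ℝ) < n := by positivity
  have hn1 : (0 : ℝ) ≤ n - 1 := by
    have : (2 : ℝ) ≤ n := by exact_mod_cast hn
    linarith
  have h6 := mul_le_mul_of_nonneg_left h4 (mul_nonneg hn0.le hn1)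
  refine le_of_mul_le_mul_left ?_ hn0
  nlinarith

/-- The first-order condition in the direction of `a i`. -/
theorem first_order_test (he : IsExpansion n a c β x σ q)
    (hs : IsIncoherentSystem n a c β δ p) (hn : 2 ≤ n) {B : Submodule ℝ (Tensor n D)}
    (hx : ‖x‖ = 1) (hgrad : sphereGrad (objective B) x = 0) (i : Fin K) :
    |inner ℝ (a i) x| * |(inner ℝ (a i) x ^ 2) ^ (n - 1) - objective (powSpan n a) x|
      ≤ subspaceError (powSpan n a) B + √(2 * c * β) + 2 * q := by
  set ζ : Fin K → ℝ := fun j => inner ℝ (a j) x with hζ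
  set F := objective (powSpan n a) x with hF
  set w := tangentPart a i x with hw
  have hwx := inner_self_tangentPart a i hx
  have hζ1 : ∀ j, |ζ j| ≤ 1 := fun j => hs.abs_inner_le j hx
  have hq := he.q_nonneg
  have hβ := hs.β_pos
  have hn0 : (1 : ℝ) ≤ n := by exact_mod_cast (by omega : 1 ≤ n)
  have hΔ := subspaceError_nonneg (powSpan n a) B
  -- the noise contributes at most the subspace error
  have h1 : |∑ j, σ j * (ζ j ^ (n - 1) * inner ℝ (a j) w)| ≤ subspaceError (powSpan n a) B := by
    have h2 := (sphereGrad_eq_zero_iff hx).1 hgrad _ hwx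
    rw [fderiv_objective] at h2
    have h3 := abs_inner_starProjection_sub_le (powSpan n a) B (tensorPow n x)
      (powDeriv n x w)
    rw [show inner ℝ (B.starProjection (tensorPow n x)) (powDeriv n x w) = 0 by linarith,
      sub_zero, norm_tensorPow, hx, one_pow, mul_one] at h3
    have h4 : ‖powDeriv n x w‖ ≤ n := by
      refine le_of_sq_le_sq ?_ (by positivity)
      rw [norm_powDeriv_sq n hx hwx, hs.norm_tangentPart_sq i hx]
      nlinarith [sq_nonneg (inner ℝ (a i) x)]
    have h5 : inner ℝ ((powSpan n a).starProjection (tensorPow n x)) (powDeriv n x w)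
        = n * ∑ j, σ j * (ζ j ^ (n - 1) * inner ℝ (a j) w) := by
      rw [he.inner_proj, Finset.mul_sum]
      refine Finset.sum_congr rfl fun j _ => ?_
      rw [inner_powDeriv, real_inner_comm, real_inner_comm (a j)]
      ring
    rw [h5, abs_mul, abs_of_nonneg (by positivity : (0 : ℝ) ≤ n)] at h3
    have h6 := h3.trans (mul_le_mul_of_nonneg_left h4 hΔ)
    nlinarith
  have h2 : ∑ j, σ j * (ζ j ^ (n - 1) * inner ℝ (a j) w)
      = ∑ j, σ j * (ζ j ^ (n - 1) * inner ℝ (a j) (a i)) - ζ i * F := by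
    rw [hF, he.objective_eq, Finset.mul_sum, ← Finset.sum_sub_distrib]
    refine Finset.sum_congr rfl fun j _ => ?_
    rw [hw, inner_tangentPart]
    have : (inner ℝ (a j) x : ℝ) ^ n = inner ℝ (a j) x ^ (n - 1) * inner ℝ (a j) x := by
      rw [← pow_succ, Nat.sub_add_cancel (by omega)]
    rw [this]; ring
  set S := (heavy a β x).erase i with hS
  set R := Finset.univ.erase i \ S with hR
  have h3 : |∑ j ∈ S, σ j * (ζ j ^ (n - 1) * inner ℝ (a j) (a i))| ≤ √(2 * c * β) := by
    refine Real.abs_le_sqrt ((Finset.sum_mul_sq_le_sq_mul_sq _ _ _).trans ?_)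
    have h4 : ∑ j ∈ S, σ j ^ 2 ≤ c := (Finset.sum_le_sum_of_subset_of_nonneg
      (Finset.subset_univ _) fun _ _ _ => sq_nonneg _).trans (he.sum_sq_le hs hx)
    have h5 : ∑ j ∈ S, (ζ j ^ (n - 1) * inner ℝ (a j) (a i)) ^ 2 ≤ β * 2 := by
      have h6 : ∑ j ∈ S, (ζ j ^ (n - 1) * inner ℝ (a j) (a i)) ^ 2
          ≤ β * ∑ j ∈ S, ζ j ^ 2 := by
        rw [Finset.mul_sum]
        refine Finset.sum_le_sum fun j hj => ?_
        rw [mul_pow, mul_comm]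
        refine mul_le_mul (hs.corr _ _ (Finset.ne_of_mem_erase hj)) ?_ (sq_nonneg _) hβ.le
        rw [← pow_mul, mul_comm, pow_mul]
        exact pow_le_of_le_one (sq_nonneg _) ((sq_le_one_iff_abs_le_one _).2 (hζ1 j)) (by omega)
      refine h6.trans (mul_le_mul_of_nonneg_left ?_ hβ.le)
      have h7 := hs.sum_heavy_le hx x
      rw [hx] at h7
      have h8 : ∑ j ∈ S, ζ j ^ 2 ≤ ∑ j ∈ heavy a β x, ζ j ^ 2 :=
        Finset.sum_le_sum_of_subset_of_nonneg (Finset.erase_subset _ _) fun _ _ _ => sq_nonneg _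
      refine h8.trans (h7.trans ?_)
      linarith [hs.δ_le]
    have h9 := mul_le_mul h4 h5 (Finset.sum_nonneg fun _ _ => sq_nonneg _)
      (by linarith [hs.one_le])
    linarith
  have h4 : |∑ j ∈ R, σ j * (ζ j ^ (n - 1) * inner ℝ (a j) (a i))| ≤ q := by
    refine he.tail _ _ fun j hj => ?_
    simp only [hR, hS, Finset.mem_sdiff, Finset.mem_erase, Finset.mem_univ, and_true, heavy,
      Finset.mem_filter, true_and, not_and, not_lt] at hj
    rw [mul_pow, ← pow_mul, mul_comm (n - 1), pow_mul]
    have e : β ^ n = β ^ (n - 1) * β := by rw [← pow_succ, Nat.sub_add_cancel (by omega)]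
    rw [e]
    exact mul_le_mul (pow_le_pow_left₀ (sq_nonneg _) (hj.2 hj.1) _) (hs.corr _ _ hj.1)
      (sq_nonneg _) (by positivity)
  have h5 : ∑ j, σ j * (ζ j ^ (n - 1) * inner ℝ (a j) (a i))
      = σ i * ζ i ^ (n - 1) + (∑ j ∈ R, σ j * (ζ j ^ (n - 1) * inner ℝ (a j) (a i))
        + ∑ j ∈ S, σ j * (ζ j ^ (n - 1) * inner ℝ (a j) (a i))) := by
    rw [hR, Finset.sum_sdiff (Finset.erase_subset_erase _ (Finset.subset_univ _)),
      ← Finset.add_sum_erase _ _ (Finset.mem_univ i), hs.inner_self_eq, mul_one]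
  have h6 : |(σ i - ζ i ^ n) * ζ i ^ (n - 1)| ≤ q := by
    rw [abs_mul, abs_pow]
    exact (mul_le_mul (he.close i) (pow_le_one₀ (abs_nonneg _) (hζ1 i)) (by positivity)
      hq).trans_eq (mul_one q)
  rw [← abs_mul]
  have e : inner ℝ (a i) x * ((inner ℝ (a i) x ^ 2) ^ (n - 1) - F)
      = ζ i ^ n * ζ i ^ (n - 1) - ζ i * F := by
    change ζ i * ((ζ i ^ 2) ^ (n - 1) - F) = _
    have : ζ i ^ n = ζ i ^ (n - 1) * ζ i := by
      rw [← pow_succ, Nat.sub_add_cancel (by omega)]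
    rw [this]; ring
  rw [e]
  rw [h2, h5] at h1
  rw [abs_le] at *
  constructor <;> linarith [h1.1, h1.2, h3.1, h3.2, h4.1, h4.2, h6.1, h6.2]

end IsExpansion

end SPM

namespace SPM

variable {n D K p : ℕ} {a : Fin K → Vec D} {c β δ : ℝ}
variable {x : Vec D} {σ : Fin K → ℝ} {q : ℝ}

/-! ### The Hessian near a component -/

theorem sphereHess_smul (f : Vec D → ℝ) (x z : Vec D) (t : ℝ) :
    sphereHess f x (t • z) = t ^ 2 * sphereHess f x z := by
  simp only [sphereHess, map_smul, smul_apply, smul_eq_mul, norm_smul,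
    mul_pow, Real.norm_eq_abs, sq_abs]
  ring

theorem sq_inner_add_sq_inner_le_one {b z : Vec D} (hb : ‖b‖ = 1) (hx : ‖x‖ = 1) (hz : ‖z‖ = 1)
    (hxz : inner ℝ x z = 0) : inner ℝ b x ^ 2 + inner ℝ b z ^ 2 ≤ 1 := by
  have h := sq_nonneg ‖b - ((inner ℝ b x : ℝ) • x + (inner ℝ b z : ℝ) • z)‖
  have e : ‖b - ((inner ℝ b x : ℝ) • x + (inner ℝ b z : ℝ) • z)‖ ^ 2
      = 1 - (inner ℝ b x ^ 2 + inner ℝ b z ^ 2) := by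
    have hzx : inner ℝ z x = 0 := by rw [real_inner_comm]; exact hxz
    rw [← real_inner_self_eq_norm_sq]
    simp only [inner_sub_left, inner_sub_right, inner_add_left, inner_add_right, inner_smul_left,
      inner_smul_right, conj_trivial, real_inner_self_eq_norm_sq, hb, hx, hz, hxz, hzx,
      real_inner_comm b x, real_inner_comm b z]
    ring
  linarith

theorem sq_inner_le_indicator {z : Vec D} (j : Fin K)
    (h : ¬(inner ℝ (a j) x ^ 2 ≤ β ∧ inner ℝ (a j) z ^ 2 ≤ β)) :
    inner ℝ (a j) z ^ 2 ≤ (if j ∈ heavy a β x then inner ℝ (a j) z ^ 2 else 0)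
      + (if j ∈ heavy a β z then inner ℝ (a j) z ^ 2 else 0) := by
  have h0 := sq_nonneg (inner ℝ (a j) z : ℝ)
  by_cases h1 : inner ℝ (a j) x ^ 2 ≤ β
  · have h2 : j ∈ heavy a β z := by
      simpa [heavy] using fun h3 => h ⟨h1, h3⟩
    rw [if_pos h2]
    split_ifs <;> linarith
  · have h2 : j ∈ heavy a β x := by simpa [heavy] using h1
    rw [if_pos h2]
    split_ifs <;> linarith

namespace IsIncoherentSystem

section
variable (hs : IsIncoherentSystem n a c β δ p)
include hs

/-- Sums over all indices of a quantity that is small where `⟨a_j, z⟩` is: the indices heavy for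
`x` or `z` are controlled by the Bessel bound. -/
theorem sum_indicator_le {z : Vec D} (hx : ‖x‖ = 1) (hz : ‖z‖ = 1) :
    ∑ j, ((if j ∈ heavy a β x then inner ℝ (a j) z ^ 2 else 0)
      + (if j ∈ heavy a β z then inner ℝ (a j) z ^ 2 else 0)) ≤ 4 := by
  rw [Finset.sum_add_distrib, Finset.sum_ite_mem, Finset.sum_ite_mem, Finset.univ_inter,
    Finset.univ_inter]
  have h1 := hs.sum_heavy_le hx z
  have h2 := hs.sum_heavy_le hz z
  rw [hz] at h1 h2
  linarith [hs.δ_le]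

theorem sum_pow_mul_sq_le (hn : 2 ≤ n) {z : Vec D} (hx : ‖x‖ = 1) (hz : ‖z‖ = 1)
    (hxz : inner ℝ x z = 0) (i : Fin K) {v : ℝ} (hv : 1 - inner ℝ (a i) x ^ 2 = v) :
    ∑ j, (inner ℝ (a j) x ^ 2) ^ (n - 1) * inner ℝ (a j) z ^ 2
      ≤ 5 * v + 4 * δ + K * β ^ n := by
  set I : Fin K → ℝ := fun j => (if j ∈ heavy a β x then inner ℝ (a j) z ^ 2 else 0)
      + (if j ∈ heavy a β z then inner ℝ (a j) z ^ 2 else 0) with hI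
  have hβ := hs.β_pos
  have hI0 : ∀ j, 0 ≤ I j := fun j => by simp only [hI]; positivity
  have hζ : ∀ j, inner ℝ (a j) x ^ 2 ≤ 1 := fun j =>
    (sq_le_one_iff_abs_le_one _).2 (hs.abs_inner_le j hx)
  have hv0 : 0 ≤ v := by linarith [hζ i]
  have hδ := hs.δ_nonneg
  have hterm : ∀ j, (inner ℝ (a j) x ^ 2) ^ (n - 1) * inner ℝ (a j) z ^ 2
      ≤ (if j = i then v else 0) + (δ + v) * I j + β ^ n := by
    intro j
    have hb := sq_inner_add_sq_inner_le_one (hs.norm_eq j) hx hz hxz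
    have hp : (inner ℝ (a j) x ^ 2) ^ (n - 1) ≤ inner ℝ (a j) x ^ 2 :=
      pow_le_of_le_one (sq_nonneg _) (hζ j) (by omega)
    have hmul : (inner ℝ (a j) x ^ 2) ^ (n - 1) * inner ℝ (a j) z ^ 2
        ≤ inner ℝ (a j) x ^ 2 * inner ℝ (a j) z ^ 2 := by gcongr
    have hpos1 := mul_nonneg (add_nonneg hδ hv0) (hI0 j)
    have hpos2 := pow_nonneg hβ.le n
    by_cases hji : j = i
    · subst hji
      rw [if_pos rfl]
      nlinarith [sq_nonneg (inner ℝ (a j) x : ℝ), sq_nonneg (inner ℝ (a j) z : ℝ), hζ j]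
    rw [if_neg hji]
    by_cases hl : inner ℝ (a j) x ^ 2 ≤ β ∧ inner ℝ (a j) z ^ 2 ≤ β
    · have e : β ^ n = β ^ (n - 1) * β := by rw [← pow_succ, Nat.sub_add_cancel (by omega)]
      have := mul_le_mul (pow_le_pow_left₀ (sq_nonneg _) hl.1 (n - 1)) hl.2 (sq_nonneg _)
        (by positivity)
      rw [← e] at this
      linarith
    · have h1 := sq_inner_le_indicator j hl
      have h2 := hs.sq_inner_add_sq_inner_le hji hx
      have := mul_le_mul (show inner ℝ (a j) x ^ 2 ≤ δ + v by linarith) h1 (sq_nonneg _)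
        (by linarith)
      linarith
  refine (Finset.sum_le_sum fun j _ => hterm j).trans ?_
  rw [Finset.sum_add_distrib, Finset.sum_add_distrib, ← Finset.mul_sum]
  simp only [Finset.sum_ite_eq', Finset.mem_univ, if_true, Finset.sum_const, Finset.card_univ,
    Fintype.card_fin, nsmul_eq_mul]
  have h4 := mul_le_mul_of_nonneg_left (hs.sum_indicator_le hx hz) (add_nonneg hδ hv0)
  linarith

end

end IsIncoherentSystem

namespace IsExpansion

theorem sum_hess_le (he : IsExpansion n a c β x σ q) (hs : IsIncoherentSystem n a c β δ p)
    (hn : 2 ≤ n) {z : Vec D} (hx : ‖x‖ = 1) (hz : ‖z‖ = 1)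
    (hxz : inner ℝ x z = 0) (i : Fin K) {v : ℝ} (hv : 1 - inner ℝ (a i) x ^ 2 = v) :
    ∑ j, σ j * (inner ℝ (a j) x ^ (n - 2) * inner ℝ (a j) z ^ 2)
      ≤ 5 * v + 4 * δ + (5 + v) * q := by
  set I : Fin K → ℝ := fun j => (if j ∈ heavy a β x then inner ℝ (a j) z ^ 2 else 0)
      + (if j ∈ heavy a β z then inner ℝ (a j) z ^ 2 else 0) with hI
  have hβ := hs.β_pos
  have hq := he.q_nonneg
  have hI0 : ∀ j, 0 ≤ I j := fun j => by simp only [hI]; positivity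
  have hζ1 : ∀ j, |inner ℝ (a j) x| ≤ 1 := fun j => hs.abs_inner_le j hx
  have hζ : ∀ j, inner ℝ (a j) x ^ 2 ≤ 1 := fun j => (sq_le_one_iff_abs_le_one _).2 (hζ1 j)
  have hv0 : 0 ≤ v := by linarith [hζ i]
  have hδ := hs.δ_nonneg
  set R := Finset.univ.filter fun j => inner ℝ (a j) x ^ 2 ≤ β ∧ inner ℝ (a j) z ^ 2 ≤ β with hR
  rw [← Finset.sum_add_sum_compl R]
  have h1 : ∑ j ∈ R, σ j * (inner ℝ (a j) x ^ (n - 2) * inner ℝ (a j) z ^ 2) ≤ q := by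
    refine (le_abs_self _).trans (he.tail _ _ fun j hj => ?_)
    obtain ⟨-, hj1, hj2⟩ := Finset.mem_filter.1 hj
    have e : β ^ n = β ^ (n - 2) * β ^ 2 := by rw [← pow_add, Nat.sub_add_cancel hn]
    rw [e, mul_pow, ← pow_mul, mul_comm (n - 2), pow_mul]
    gcongr
  have hterm : ∀ j ∈ Rᶜ, σ j * (inner ℝ (a j) x ^ (n - 2) * inner ℝ (a j) z ^ 2)
      ≤ (if j = i then (1 + q) * v else 0) + (δ + v + q) * I j := by
    intro j hj
    have hl : ¬(inner ℝ (a j) x ^ 2 ≤ β ∧ inner ℝ (a j) z ^ 2 ≤ β) := by simpa [hR] using hj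
    have hI1 := sq_inner_le_indicator j hl
    have hσ : |σ j| ≤ inner ℝ (a j) x ^ 2 + q := by
      have h2 := abs_add_le (inner ℝ (a j) x ^ n) (σ j - inner ℝ (a j) x ^ n)
      rw [add_sub_cancel, abs_pow] at h2
      linarith [he.close j, pow_le_sq_of_abs_le_one (hζ1 j) hn]
    have h2 : σ j * (inner ℝ (a j) x ^ (n - 2) * inner ℝ (a j) z ^ 2)
        ≤ |σ j| * inner ℝ (a j) z ^ 2 := by
      refine (le_abs_self _).trans ?_
      rw [abs_mul, abs_mul, abs_pow, abs_of_nonneg (sq_nonneg (inner ℝ (a j) z : ℝ))]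
      refine mul_le_mul_of_nonneg_left ?_ (abs_nonneg _)
      exact mul_le_of_le_one_left (sq_nonneg _) (pow_le_one₀ (abs_nonneg _) (hζ1 j))
    have hpos1 := mul_nonneg (show 0 ≤ δ + v + q by positivity) (hI0 j)
    by_cases hji : j = i
    · subst hji
      rw [if_pos rfl]
      have hb := sq_inner_add_sq_inner_le_one (hs.norm_eq j) hx hz hxz
      have := mul_le_mul (show |σ j| ≤ 1 + q by linarith [hζ j])
        (show inner ℝ (a j) z ^ 2 ≤ v by linarith) (sq_nonneg _) (by positivity)
      linarith
    · rw [if_neg hji]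
      have h3 := hs.sq_inner_add_sq_inner_le hji hx
      have := mul_le_mul (show |σ j| ≤ δ + v + q by linarith) hI1 (sq_nonneg _) (by positivity)
      linarith
  have h2 : ∑ j ∈ Rᶜ, σ j * (inner ℝ (a j) x ^ (n - 2) * inner ℝ (a j) z ^ 2)
      ≤ ∑ j, ((if j = i then (1 + q) * v else 0) + (δ + v + q) * I j) := by
    refine (Finset.sum_le_sum hterm).trans
      (Finset.sum_le_sum_of_subset_of_nonneg (Finset.subset_univ _) fun j _ _ => ?_)
    have := mul_nonneg (show 0 ≤ δ + v + q by positivity) (hI0 j)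
    split_ifs
    · positivity
    · linarith
  rw [Finset.sum_add_distrib, ← Finset.mul_sum] at h2
  simp only [Finset.sum_ite_eq', Finset.mem_univ, if_true] at h2
  have h4 := mul_le_mul_of_nonneg_left (hs.sum_indicator_le hx hz)
    (show 0 ≤ δ + v + q by positivity)
  linarith

/-- Upper bound on the Riemannian Hessian, useful when `v = 1 - ⟨a_i, x⟩²` is small. -/
theorem sphereHess_le (he : IsExpansion n a c β x σ q) (hs : IsIncoherentSystem n a c β δ p)
    (hn : 2 ≤ n) {z : Vec D} (hx : ‖x‖ = 1) (hz : ‖z‖ = 1)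
    (hxz : inner ℝ x z = 0) (i : Fin K) {v : ℝ} (hv : 1 - inner ℝ (a i) x ^ 2 = v) :
    sphereHess (objective (powSpan n a)) x z
      ≤ 2 * n * (c * n * (5 * v + 4 * δ + K * β ^ n) + n * (5 * v + 4 * δ + (5 + v) * q)
        - 1 + n * v) := by
  have h1 := hs.norm_starProjection_sq_le (powDeriv n x z)
  have h2 := hs.sum_pow_mul_sq_le hn hx hz hxz i hv
  have h3 := he.sum_hess_le hs hn hx hz hxz i hv
  have h4 : ∑ j, inner ℝ (powDeriv n x z) (tensorPow n (a j)) ^ 2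
      = n ^ 2 * ∑ j, (inner ℝ (a j) x ^ 2) ^ (n - 1) * inner ℝ (a j) z ^ 2 := by
    rw [Finset.mul_sum]
    refine Finset.sum_congr rfl fun j _ => ?_
    rw [inner_powDeriv, real_inner_comm, real_inner_comm (a j)]
    ring
  have h5 : inner ℝ ((powSpan n a).starProjection (tensorPow n x)) (powDeriv₂ n x z)
      = n * (n - 1) * ∑ j, σ j * (inner ℝ (a j) x ^ (n - 2) * inner ℝ (a j) z ^ 2) := by
    rw [he.inner_proj, Finset.mul_sum]
    refine Finset.sum_congr rfl fun j _ => ?_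
    rw [inner_powDeriv₂ n hn, real_inner_comm, real_inner_comm (a j)]
    ring
  have h6 : 1 - n * v ≤ objective (powSpan n a) x := by
    have h7 := one_add_mul_le_pow (a := -v) (by
      rw [← hv]; nlinarith [sq_nonneg (inner ℝ (a i) x : ℝ)]) n
    have h8 := hs.pow_le_objective x i
    rw [show 1 + -v = inner ℝ (a i) x ^ 2 by linarith] at h7
    linarith
  rw [sphereHess_objective, h5, hz]
  rw [h4] at h1
  have hc := hs.one_le
  have hδ := hs.δ_nonneg
  have hq := he.q_nonneg
  have hn2 : (2 : ℝ) ≤ n := by exact_mod_cast hn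
  have hv0 : 0 ≤ v := by
    linarith [(sq_le_one_iff_abs_le_one _).2 (hs.abs_inner_le i hx)]
  have h9 := mul_le_mul_of_nonneg_left h2 (show (0 : ℝ) ≤ 2 * c * n ^ 2 by positivity)
  have h10 := mul_le_mul_of_nonneg_left h3
    (mul_nonneg (show (0 : ℝ) ≤ 2 * n by positivity) (show (0 : ℝ) ≤ n - 1 by linarith))
  have h11 := mul_nonneg (show (0 : ℝ) ≤ 2 * n by positivity)
    (show 0 ≤ 5 * v + 4 * δ + (5 + v) * q by positivity)
  have h12 := mul_le_mul_of_nonneg_left h6 (show (0 : ℝ) ≤ 2 * n by positivity)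
  linarith

end IsExpansion

end SPM

namespace SPM

/-! ### Small parameters -/

/-- The height of the caps around the signed components. -/
noncomputable def capHeight (n : ℕ) (c : ℝ) : ℝ := 1 / (100 * c * n)

/-- The tolerance for all error terms. The factor `4 ^ n` absorbs `⟨a_i, x⟩ ^ (2 n)`, which is at
least `0.3 ^ n` at the critical points of interest. -/
noncomputable def tolerance (n : ℕ) (c : ℝ) : ℝ := capHeight n c / (40 * 4 ^ n)

section
variable {n : ℕ} {c : ℝ}

theorem capHeight_pos (hn : 2 ≤ n) (hc : 1 ≤ c) : 0 < capHeight n c := by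
  unfold capHeight; positivity

theorem mul_mul_capHeight (hn : 2 ≤ n) (hc : 1 ≤ c) : c * n * capHeight n c = 1 / 100 := by
  unfold capHeight; field_simp

theorem mul_capHeight_le (hn : 2 ≤ n) (hc : 1 ≤ c) : n * capHeight n c ≤ 1 / 100 := by
  have h1 := mul_mul_capHeight hn hc
  have h2 := mul_pos (show (0 : ℝ) < n by positivity) (capHeight_pos hn hc)
  nlinarith

theorem capHeight_le (hn : 2 ≤ n) (hc : 1 ≤ c) : capHeight n c ≤ 1 / 200 := by
  have h1 := mul_capHeight_le hn hc
  have h2 : (2 : ℝ) ≤ n := by exact_mod_cast hn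
  nlinarith [capHeight_pos hn hc]

theorem tolerance_pos (hn : 2 ≤ n) (hc : 1 ≤ c) : 0 < tolerance n c := by
  have := capHeight_pos hn hc
  unfold tolerance; positivity

theorem tolerance_mul_pow (n : ℕ) (c : ℝ) : tolerance n c * 4 ^ n = capHeight n c / 40 := by
  unfold tolerance; field_simp

theorem mul_tolerance_le (hn : 2 ≤ n) (hc : 1 ≤ c) : 640 * tolerance n c ≤ capHeight n c := by
  have h1 := tolerance_mul_pow n c
  have h2 : (4 : ℝ) ^ 2 ≤ 4 ^ n := pow_le_pow_right₀ (by norm_num) hn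
  nlinarith [tolerance_pos hn hc]

end

/-- The numerical part of the localization: `u = ⟨a_i, x⟩²`, `F` is the noiseless objective, `Δ`
the noise, and the hypotheses are the bounds on `F` together with the two tests. The second-order
test gives `u ≥ 0.3`; then `F` is bounded below, the noise is negligible, and the same test gives
`u ≥ 0.6`. With the first-order test, which identifies `F` with `u ^ (n - 1)` up to a small error,
this implies `u > 1 - r`. -/
theorem one_sub_lt_of_tests {n : ℕ} {τ r F Δ q u δ : ℝ} (hn : 2 ≤ n) (hτ : 0 < τ)
    (hτr : 640 * τ ≤ r) (hr : r ≤ 1 / 200) (hnτ : n * τ ≤ 1 / 64000) (hτ4 : τ * 4 ^ n = r / 40)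
    (hδ0 : 0 ≤ δ) (hδ : δ ≤ τ) (hu0 : 0 ≤ u) (hu1 : u ≤ 1) (hF0 : 0 < F) (hq0 : 0 ≤ q)
    (hq : q ≤ τ) (hqF : q ≤ τ * F) (hΔ : Δ ≤ τ) (hΔF : 4 * Δ ≤ F)
    (hlow : u ^ n ≤ F) (hup : F ≤ (1 + δ) * u ^ (n - 1) + 3 * q)
    (hup2 : 0.6 ≤ u → F ≤ u ^ n + (1 + δ - u) ^ n + 3 * q)
    (htest : (2 * n - 1) * (u ^ (n - 1) * (1 - u) ^ 2)
      ≤ (F + 4 * Δ) * (1 - u) + 7 * (n - 1) * q)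
    (hfirst : u * |u ^ (n - 1) - F| ≤ Δ + τ + 2 * q) : 1 - r < u := by
  have hn2 : (2 : ℝ) ≤ n := by exact_mod_cast hn
  have hP0 : 0 ≤ u ^ (n - 1) := pow_nonneg hu0 _
  have hnn : n = (n - 1) + 1 := by omega
  have hun : u ^ n = u * u ^ (n - 1) := by rw [← pow_succ', ← hnn]
  have hpow : (1 + δ - u) ^ n = (1 + δ - u) ^ (n - 1) * (1 + δ - u) := by rw [← pow_succ, ← hnn]
  have hpow2 : 0.6 ≤ u → (1 + δ - u) ^ (n - 1) ≤ 0.7 * u ^ (n - 1) := by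
    intro hu6
    calc (1 + δ - u) ^ (n - 1) ≤ (0.7 * u) ^ (n - 1) :=
          pow_le_pow_left₀ (by linarith) (by linarith) _
      _ = 0.7 ^ (n - 1) * u ^ (n - 1) := by rw [mul_pow]
      _ ≤ 0.7 * u ^ (n - 1) :=
          mul_le_mul_of_nonneg_right
            (pow_le_of_le_one (by norm_num) (by norm_num) (by omega)) hP0
  have hquarter : 0.3 ≤ u → ∀ m : ℕ, m ≤ n → 1 ≤ u ^ m * 4 ^ n := by
    intro hu3 m hm
    have h1 : (4 : ℝ) ^ m ≤ 4 ^ n := pow_le_pow_right₀ (by norm_num) hm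
    have h2 : (1 : ℝ) ≤ (u * 4) ^ m := one_le_pow₀ (by linarith)
    rw [mul_pow] at h2
    exact h2.trans (mul_le_mul_of_nonneg_left h1 (pow_nonneg hu0 m))
  have hquarter' : 0.3 ≤ u → ∀ m : ℕ, m ≤ n → τ ≤ u ^ m * (r / 40) := by
    intro hu3 m hm
    have := mul_le_mul_of_nonneg_left (hquarter hu3 m hm) hτ.le
    rw [← hτ4]; linarith
  generalize u ^ (n - 1) = P at *
  have hFP : F ≤ 1.001 * P := by
    have h1 : δ * P ≤ τ * P := mul_le_mul_of_nonneg_right hδ hP0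
    have h2 : τ * P ≤ 1 / 100000 * P := mul_le_mul_of_nonneg_right (by linarith) hP0
    have h3 : τ * F ≤ 1 / 100000 * F := mul_le_mul_of_nonneg_right (by linarith) hF0.le
    linarith
  have hPpos : 0 < P := by linarith
  -- the second-order test, for noise at most `κ F / 4`
  have hstep : ∀ κ : ℝ, 0 ≤ κ → 4 * Δ ≤ κ * F → 0.4 ≤ 1 - u →
      3 * (1 - u) ≤ (1 + κ + 0.001) * 1.001 := by
    intro κ hκ0 hκ hv
    have h1 : (n - 1 : ℝ) * q ≤ n * (τ * F) :=
      mul_le_mul (by linarith) hqF hq0 (by positivity)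
    have h2 : n * (τ * F) ≤ 1 / 64000 * F := by
      rw [← mul_assoc]; exact mul_le_mul_of_nonneg_right hnτ hF0.le
    have h3 : F * 0.4 ≤ F * (1 - u) := mul_le_mul_of_nonneg_left hv hF0.le
    have h4 : (F + 4 * Δ) * (1 - u) ≤ (F + κ * F) * (1 - u) :=
      mul_le_mul_of_nonneg_right (by linarith) (by linarith)
    have h6 : 3 * (P * (1 - u) ^ 2) ≤ (2 * n - 1) * (P * (1 - u) ^ 2) :=
      mul_le_mul_of_nonneg_right (by linarith) (by positivity)
    have h7 : (1 + κ + 0.001) * (1 - u) * F ≤ (1 + κ + 0.001) * (1 - u) * (1.001 * P) :=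
      mul_le_mul_of_nonneg_left hFP (mul_nonneg (by linarith) (by linarith))
    have h5 : (3 * (1 - u)) * (P * (1 - u)) ≤ ((1 + κ + 0.001) * 1.001) * (P * (1 - u)) := by
      linarith
    exact le_of_mul_le_mul_right h5 (mul_pos hPpos (by linarith))
  have hu3 : 0.3 ≤ u := by
    by_contra! hcon
    have := hstep 1 (by norm_num) (by linarith) (by linarith)
    linarith
  have hu6 : 0.6 ≤ u := by
    by_contra! hcon
    have h1 := hquarter' hu3 n le_rfl
    have h2 : u ^ n * (r / 40) ≤ F * (1 / 8000) :=
      mul_le_mul hlow (by linarith) (by linarith) hF0.le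
    have := hstep 0.001 (by norm_num) (by linarith) (by linarith)
    linarith
  have hτP : τ ≤ P * (r / 40) := by
    have h1 := hquarter' hu3 n le_rfl
    have h2 : u * P * (r / 40) ≤ 1 * P * (r / 40) := by gcongr; linarith
    rw [hun] at h1
    linarith
  have hPF : P - F ≤ 7 * τ := by
    have h2 : 0.6 * |P - F| ≤ u * |P - F| := mul_le_mul_of_nonneg_right hu6 (abs_nonneg _)
    linarith [le_abs_self (P - F)]
  have hup3 := hup2 hu6
  have h1 : (1 + δ - u) ^ n ≤ 0.7 * P * (1 + δ - u) := by
    rw [hpow]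
    exact mul_le_mul_of_nonneg_right (hpow2 hu6) (by linarith)
  have h4 : (0.3 * (1 - u)) * P ≤ (0.7 * τ + 10 * (r / 40)) * P := by
    have : 0.7 * P * δ ≤ 0.7 * P * τ := mul_le_mul_of_nonneg_left hδ (by linarith)
    linarith
  have h5 := le_of_mul_le_mul_right h4 hPpos
  linarith

variable {n D K p : ℕ} {a : Fin K → Vec D} {c β δ : ℝ}

/-- Smallness of all parameters of an incoherent system relative to `tolerance n c`. -/
structure IsSmallSystem (n : ℕ) {D K : ℕ} (a : Fin K → Vec D) (c β δ : ℝ) (p : ℕ) : Prop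
    extends IsIncoherentSystem n a c β δ p where
  two_le_n : 2 ≤ n
  δ_small : δ ≤ tolerance n c
  β_small : β ≤ tolerance n c ^ 2 / (2 * c)
  tail_small : K * β ^ n ≤ tolerance n c ^ 2 / (2 * c)
  nonempty : 0 < K

namespace IsSmallSystem

variable (hs : IsSmallSystem n a c β δ p)
include hs

theorem tolerance_bounds : 0 < tolerance n c ∧ 640 * tolerance n c ≤ capHeight n c ∧
    capHeight n c ≤ 1 / 200 ∧ tolerance n c ^ 2 / (2 * c) ≤ tolerance n c / 1000 := by
  have h1 := tolerance_pos hs.two_le_n hs.one_le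
  have h2 := mul_tolerance_le hs.two_le_n hs.one_le
  have h3 := capHeight_le hs.two_le_n hs.one_le
  refine ⟨h1, h2, h3, ?_⟩
  have hc := hs.one_le
  rw [div_le_iff₀ (by positivity)]
  nlinarith

theorem sqrt_le_tolerance {x : Vec D} (hx : ‖x‖ = 1) :
    √(c * objective (powSpan n a) x * (K * β ^ n)) ≤ tolerance n c := by
  refine Real.sqrt_le_iff.2 ⟨hs.tolerance_bounds.1.le, ?_⟩
  have hc := hs.one_le
  have hβ := hs.β_pos
  have h1 := objective_le_one (powSpan n a) hx
  have h2 := hs.tail_small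
  rw [le_div_iff₀ (by positivity)] at h2
  have h3 : 0 ≤ c * (K * β ^ n) := by positivity
  nlinarith

theorem sqrt_le_tolerance_mul {x : Vec D}
    (h : c / tolerance n c ^ 2 * (K * β ^ n) ≤ objective (powSpan n a) x) :
    √(c * objective (powSpan n a) x * (K * β ^ n))
      ≤ tolerance n c * objective (powSpan n a) x := by
  have hF := objective_nonneg (powSpan n a) x
  have hτ := hs.tolerance_bounds.1
  refine Real.sqrt_le_iff.2 ⟨by positivity, ?_⟩
  rw [div_mul_eq_mul_div, div_le_iff₀ (by positivity)] at h
  nlinarith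

/-- Near a component the Riemannian Hessian of the objective of any nearby subspace is at most
`-n`. -/
theorem sphereHess_le_neg {B : Submodule ℝ (Tensor n D)}
    (hΔ : subspaceError (powSpan n a) B ≤ tolerance n c) {x z : Vec D} (hx : ‖x‖ = 1)
    (hxz : inner ℝ x z = 0) {i : Fin K} (hi : 1 - 2 * capHeight n c ≤ inner ℝ (a i) x ^ 2) :
    sphereHess (objective B) x z ≤ -n * ‖z‖ ^ 2 := by
  have unit : ∀ z : Vec D, ‖z‖ = 1 → inner ℝ x z = 0 → sphereHess (objective B) x z ≤ -n := by
    intro z hz hxz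
    obtain ⟨σ, he⟩ := hs.exists_isExpansion x
    have hq0 := he.q_nonneg
    have hq := hs.sqrt_le_tolerance hx
    have h1 := he.sphereHess_le hs.toIsIncoherentSystem hs.two_le_n hx hz hxz i rfl
    set q := √(c * objective (powSpan n a) x * (K * β ^ n))
    set v := 1 - inner ℝ (a i) x ^ 2 with hv
    have h2 := (abs_le.1 (abs_sphereHess_sub_le hs.two_le_n (powSpan n a) B hx hxz)).1
    rw [hz] at h2
    obtain ⟨hτ, hτr, hr, hE⟩ := hs.tolerance_bounds
    have hn : (0 : ℝ) < n := by have := hs.two_le_n; positivity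
    have hc := hs.one_le
    have hcn := mul_mul_capHeight hs.two_le_n hs.one_le
    have hnr := mul_capHeight_le hs.two_le_n hs.one_le
    have hv0 : 0 ≤ v := by
      have := (sq_le_one_iff_abs_le_one _).2 (hs.abs_inner_le i hx)
      linarith
    have hvr : v ≤ 2 * capHeight n c := by linarith
    have hδ := hs.δ_small
    have hδ0 := hs.δ_nonneg
    have htail := hs.tail_small
    have h3 : c * n * (5 * v + 4 * δ + K * β ^ n) ≤ c * n * (11 * capHeight n c) := by
      gcongr; linarith
    have h4 : n * (5 * v + 4 * δ + (5 + v) * q) ≤ n * (11 * capHeight n c) := by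
      have : (5 + v) * q ≤ 6 * q := by gcongr; linarith
      gcongr; linarith
    have h5 : n * v ≤ n * (2 * capHeight n c) := by gcongr
    have h6 : c * n * (5 * v + 4 * δ + K * β ^ n) + n * (5 * v + 4 * δ + (5 + v) * q)
        - 1 + n * v + 4 * subspaceError (powSpan n a) B ≤ -(1 / 2) := by
      linarith
    have h7 := mul_le_mul_of_nonneg_left h6 (show (0 : ℝ) ≤ 2 * n by positivity)
    linarith
  rcases eq_or_ne z 0 with rfl | h0
  · simp [sphereHess]
  · have hzn : ‖z‖ ≠ 0 := norm_ne_zero_iff.2 h0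
    have h1 := unit (‖z‖⁻¹ • z) (by rw [norm_smul, norm_inv, norm_norm, inv_mul_cancel₀ hzn])
      (by rw [inner_smul_right, hxz, mul_zero])
    have h2 : z = ‖z‖ • (‖z‖⁻¹ • z) := by rw [smul_smul, mul_inv_cancel₀ hzn, one_smul]
    conv_lhs => rw [h2]
    rw [sphereHess_smul]
    nlinarith [sq_nonneg ‖z‖]

/-! ### Localization of critical points -/

/-- A second-order critical point in the superlevel set is close to a signed component, namely to
the one that maximizes `⟨a_i, x⟩²`. -/
theorem exists_lt_sq_inner {B : Submodule ℝ (Tensor n D)}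
    (hΔ : subspaceError (powSpan n a) B ≤ tolerance n c) {x : Vec D}
    (hcrit : IsSecondOrderCritical (objective B) x)
    (hlev : c / tolerance n c ^ 2 * (K * β ^ n) + 5 * subspaceError (powSpan n a) B
      ≤ objective B x) :
    ∃ i, 1 - capHeight n c < inner ℝ (a i) x ^ 2 := by
  have hx : ‖x‖ = 1 := by simpa [unitSphere] using hcrit.1
  have : Nonempty (Fin K) := ⟨⟨0, hs.nonempty⟩⟩
  obtain ⟨i, -, hmax⟩ := Finset.exists_max_image Finset.univ
    (fun j => inner ℝ (a j) x ^ 2) Finset.univ_nonempty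
  refine ⟨i, ?_⟩
  obtain ⟨σ, he⟩ := hs.exists_isExpansion x
  have hn := hs.two_le_n
  have hsys := hs.toIsIncoherentSystem
  obtain ⟨hτ, hτr, hr, hE⟩ := hs.tolerance_bounds
  have hc := hs.one_le
  have hβ0 := hs.β_pos
  have hK : (0 : ℝ) < K := by exact_mod_cast hs.nonempty
  have hΔ0 := subspaceError_nonneg (powSpan n a) B
  have hF1 := (abs_le.1 (abs_objective_sub_le (powSpan n a) B hx)).1
  have hpos : 0 < c / tolerance n c ^ 2 * (K * β ^ n) := by positivity
  have hnτ : n * tolerance n c ≤ 1 / 64000 := by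
    have h1 := mul_capHeight_le hn hc
    have h2 := mul_le_mul_of_nonneg_left hτr (show (0 : ℝ) ≤ n by positivity)
    linarith
  have hsqrt : √(2 * c * β) ≤ tolerance n c := by
    refine Real.sqrt_le_iff.2 ⟨hτ.le, ?_⟩
    have := hs.β_small
    rw [le_div_iff₀ (by positivity)] at this
    linarith
  have hfirst := he.first_order_test hsys hn hx hcrit.2.1 i
  have hζ1 := hs.abs_inner_le i hx
  have habs : inner ℝ (a i) x ^ 2 ≤ |inner ℝ (a i) x| := by
    rw [← sq_abs]; exact pow_le_of_le_one (abs_nonneg _) hζ1 two_ne_zero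
  exact one_sub_lt_of_tests hn hτ hτr hr hnτ (tolerance_mul_pow n c) hs.δ_nonneg hs.δ_small
    (sq_nonneg _) ((sq_le_one_iff_abs_le_one _).2 hζ1) (by linarith) he.q_nonneg
    (hs.sqrt_le_tolerance hx) (hs.sqrt_le_tolerance_mul (by linarith)) hΔ (by linarith)
    (hs.pow_le_objective x i)
    (he.objective_le_of_forall_le hsys hn hx (sq_nonneg _) fun j => hmax j (Finset.mem_univ j))
    (fun h6 => he.objective_le_of_heavy hsys hn hx (by linarith [hs.β_small]))
    (he.second_order_test hsys hn hcrit i)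
    ((mul_le_mul_of_nonneg_right habs (abs_nonneg _)).trans (hfirst.trans (by linarith)))

end IsSmallSystem

end SPM

namespace SPM

variable {n D K p : ℕ} {a : Fin K → Vec D} {c β δ : ℝ}

/-! ### Critical points in the caps around the signed components -/

/-- The signed component `s a_i`. -/
noncomputable def signed (a : Fin K → Vec D) (k : Fin K × ℤˣ) : Vec D :=
  ((k.2 : ℤ) : ℝ) • a k.1

theorem signed_eq_or (a : Fin K → Vec D) (k : Fin K × ℤˣ) :
    signed a k = a k.1 ∨ signed a k = -a k.1 := by
  rcases Int.units_eq_one_or k.2 with h | h <;> simp [signed, h]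

theorem sq_inner_signed (a : Fin K → Vec D) (k : Fin K × ℤˣ) (x : Vec D) :
    inner ℝ x (signed a k) ^ 2 = inner ℝ (a k.1) x ^ 2 := by
  rw [real_inner_comm]
  rcases signed_eq_or a k with h | h <;> simp [h]

/-- The cap on which the Riemannian Hessian is controlled. -/
noncomputable def componentCap (n : ℕ) (a : Fin K → Vec D) (c : ℝ) (k : Fin K × ℤˣ) :
    Set (Vec D) := sphereCap (signed a k) (1 - capHeight n c)

namespace IsSmallSystem

section
variable (hs : IsSmallSystem n a c β δ p)
include hs

theorem norm_signed (k : Fin K × ℤˣ) : ‖signed a k‖ = 1 := by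
  rcases signed_eq_or a k with h | h <;> rw [h] <;> simp [hs.norm_eq]

theorem signed_mem_componentCap (k : Fin K × ℤˣ) : signed a k ∈ componentCap n a c k := by
  refine ⟨hs.norm_signed k, ?_⟩
  rw [real_inner_self_eq_norm_sq, hs.norm_signed]
  linarith [capHeight_pos hs.two_le_n hs.one_le]

theorem sphereHess_le_of_mem_componentCap {B : Submodule ℝ (Tensor n D)}
    (hΔ : subspaceError (powSpan n a) B ≤ tolerance n c) {k : Fin K × ℤˣ} :
    ∀ x ∈ componentCap n a c k, ∀ z, inner ℝ x z = 0 →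
      sphereHess (objective B) x z ≤ -n * ‖z‖ ^ 2 := by
  intro x hx z hxz
  refine hs.sphereHess_le_neg hΔ hx.1 hxz (i := k.1) ?_
  obtain ⟨-, -, hr, -⟩ := hs.tolerance_bounds
  rw [← sq_inner_signed]
  have h := pow_le_pow_left₀ (by linarith) hx.2 2
  nlinarith [sq_nonneg (capHeight n c)]

theorem one_sub_le_objective_signed (B : Submodule ℝ (Tensor n D)) (k : Fin K × ℤˣ) :
    1 - subspaceError (powSpan n a) B ≤ objective B (signed a k) := by
  have h1 := (abs_le.1 (abs_objective_sub_le (powSpan n a) B (hs.norm_signed k))).2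
  have h2 : objective (powSpan n a) (signed a k) = 1 := by
    rcases signed_eq_or a k with h | h <;> rw [h]
    · exact hs.objective_component _
    · rw [objective_neg, hs.objective_component]
  linarith

/-- Critical points in a cap maximize the objective over the cap, with quadratic decay. -/
theorem objective_le_sub {B : Submodule ℝ (Tensor n D)}
    (hΔ : subspaceError (powSpan n a) B ≤ tolerance n c) {k : Fin K × ℤˣ} {x y : Vec D}
    (hx : x ∈ componentCap n a c k) (hy : y ∈ componentCap n a c k)
    (hg : sphereGrad (objective B) x = 0) :
    objective B y ≤ objective B x - n / 2 * ‖x - y‖ ^ 2 :=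
  le_sub_of_sphereHess_le ((contDiff_objective B).of_le le_top)
    (by linarith [hs.tolerance_bounds.2.2.1]) (Nat.cast_nonneg n)
    (hs.sphereHess_le_of_mem_componentCap hΔ) hx hy hg

theorem norm_sub_signed_sq_le {B : Submodule ℝ (Tensor n D)}
    (hΔ : subspaceError (powSpan n a) B ≤ tolerance n c) {k : Fin K × ℤˣ} {x : Vec D}
    (hx : x ∈ componentCap n a c k) (hg : sphereGrad (objective B) x = 0) :
    ‖x - signed a k‖ ^ 2 ≤ 2 * subspaceError (powSpan n a) B / n := by
  have h1 := hs.objective_le_sub hΔ hx (hs.signed_mem_componentCap k) hg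
  have h2 := hs.one_sub_le_objective_signed B k
  have h3 := objective_le_one B hx.1
  have hn : (0 : ℝ) < n := by have := hs.two_le_n; positivity
  rw [le_div_iff₀ hn]
  linarith

theorem eq_of_mem_componentCap {B : Submodule ℝ (Tensor n D)}
    (hΔ : subspaceError (powSpan n a) B ≤ tolerance n c) {k : Fin K × ℤˣ} {x y : Vec D}
    (hx : x ∈ componentCap n a c k) (hy : y ∈ componentCap n a c k)
    (hgx : sphereGrad (objective B) x = 0) (hgy : objective B x ≤ objective B y) : x = y := by
  have h1 := hs.objective_le_sub hΔ hx hy hgx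
  have hn : (0 : ℝ) < n := by have := hs.two_le_n; positivity
  have h2 : n * ‖x - y‖ ^ 2 ≤ n * 0 := by linarith
  have h3 := le_of_mul_le_mul_left h2 hn
  rw [← sub_eq_zero, ← norm_eq_zero]
  exact pow_eq_zero_iff two_ne_zero |>.1 (le_antisymm h3 (sq_nonneg _))

theorem objective_le_add_tolerance (x : Vec D) (hx : ‖x‖ = 1) {m : ℝ} (hm0 : 0 ≤ m) (hm1 : m ≤ 1)
    (hm : ∀ j, inner ℝ (a j) x ^ 2 ≤ m) :
    objective (powSpan n a) x ≤ m + 4 * tolerance n c := by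
  obtain ⟨σ, he⟩ := hs.exists_isExpansion x
  have hn := hs.two_le_n
  have h1 := he.objective_le_of_forall_le hs.toIsIncoherentSystem hn hx hm0 hm
  have h2 := hs.sqrt_le_tolerance hx
  have h3 : m ^ (n - 1) ≤ m := pow_le_of_le_one hm0 hm1 (by omega)
  have h4 := mul_le_mul hs.δ_small (h3.trans hm1) (pow_nonneg hm0 _) hs.tolerance_bounds.1.le
  linarith

/-- The maximizer of the objective over a cap is an interior point, because on the boundary of the
cap the objective is smaller than at the center. -/
theorem exists_critical_mem_componentCap {B : Submodule ℝ (Tensor n D)}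
    (hΔ : subspaceError (powSpan n a) B ≤ tolerance n c) (k : Fin K × ℤˣ) :
    ∃ x ∈ componentCap n a c k, IsSecondOrderCritical (objective B) x ∧
      1 - subspaceError (powSpan n a) B ≤ objective B x := by
  have hcompact : IsCompact (componentCap n a c k) := by
    have e : componentCap n a c k = Metric.sphere 0 1 ∩
        {x | 1 - capHeight n c ≤ inner ℝ x (signed a k)} := by
      ext x; simp [componentCap, sphereCap]
    rw [e]
    exact (isCompact_sphere _ _).inter_right
      (isClosed_le continuous_const (continuous_id.inner continuous_const))
  obtain ⟨x, hx, hmax⟩ := hcompact.exists_isMaxOn ⟨_, hs.signed_mem_componentCap k⟩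
    (contDiff_objective B).continuous.continuousOn
  have hval := (hs.one_sub_le_objective_signed B k).trans (hmax (hs.signed_mem_componentCap k))
  have hin : 1 - capHeight n c < inner ℝ x (signed a k) := by
    refine lt_of_le_of_ne hx.2 fun heq => ?_
    obtain ⟨hτ, hτr, hr, -⟩ := hs.tolerance_bounds
    have hsq := sq_inner_signed a k x
    rw [← heq] at hsq
    have h1 := hs.objective_le_add_tolerance x hx.1 (m := (1 - capHeight n c) ^ 2) (sq_nonneg _)
      (by nlinarith) fun j => by
        by_cases hj : j = k.1
        · rw [hj, hsq]
        · have h2 := hs.sq_inner_add_sq_inner_le hj hx.1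
          have h3 := hs.δ_small
          nlinarith
    have h2 := (abs_le.1 (abs_objective_sub_le (powSpan n a) B hx.1)).1
    nlinarith
  have hg : sphereGrad (objective B) x = 0 := by
    refine sphereGrad_eq_zero_of_eventually_le (differentiable_objective B) hx.1 ?_
    have hc : Continuous fun y : Vec D => (inner ℝ y (signed a k) : ℝ) :=
      continuous_id.inner continuous_const
    filter_upwards [hc.continuousAt.eventually (lt_mem_nhds hin)] with y hy hy1
    exact hmax ⟨hy1, hy.le⟩
  refine ⟨x, hx, ⟨by simpa [unitSphere] using hx.1, hg, fun z hz => ?_⟩, hval⟩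
  refine (hs.sphereHess_le_of_mem_componentCap hΔ x hx z hz).trans ?_
  have : (0 : ℝ) ≤ n * ‖z‖ ^ 2 := by positivity
  linarith

theorem exists_mem_componentCap {x : Vec D} {i : Fin K} (hx : ‖x‖ = 1)
    (hi : 1 - capHeight n c < inner ℝ (a i) x ^ 2) : ∃ s : ℤˣ, x ∈ componentCap n a c (i, s) ∧
      1 - capHeight n c < inner ℝ x (signed a (i, s)) := by
  have h1 := hs.abs_inner_le i hx
  have h2 : inner ℝ (a i) x ^ 2 ≤ |inner ℝ (a i) x| := by
    rw [← sq_abs]; exact pow_le_of_le_one (abs_nonneg _) h1 two_ne_zero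
  suffices h : ∃ s : ℤˣ, 1 - capHeight n c < inner ℝ x (signed a (i, s)) from
    h.imp fun s hs => ⟨⟨hx, hs.le⟩, hs⟩
  rcases abs_cases (inner ℝ (a i) x : ℝ) with h | h
  · exact ⟨1, by rw [real_inner_comm]; simp [signed]; linarith⟩
  · exact ⟨-1, by rw [real_inner_comm]; simp [signed]; linarith⟩

/-- Distinct signed components are at distance at least one. -/
theorem one_le_norm_signed_sub_sq {k l : Fin K × ℤˣ} (hkl : k ≠ l) :
    1 ≤ ‖signed a k - signed a l‖ ^ 2 := by
  rw [norm_sub_sq_real, hs.norm_signed, hs.norm_signed]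
  by_cases h : k.1 = l.1
  · obtain ⟨i, s⟩ := k
    obtain ⟨j, t⟩ := l
    obtain rfl : i = j := h
    have e : signed a (i, t) = -signed a (i, s) := by
      rcases Int.units_eq_one_or s with h1 | h1 <;> rcases Int.units_eq_one_or t with h2 | h2 <;>
        simp_all [signed]
    rw [e, inner_neg_right, real_inner_self_eq_norm_sq, hs.norm_signed]
    norm_num
  · obtain ⟨hτ, hτr, hr, hE⟩ := hs.tolerance_bounds
    have h3 := hs.β_small
    have h4 : inner ℝ (signed a k) (signed a l) ^ 2 ≤ (1 / 2) ^ 2 := by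
      rw [sq_inner_signed, sq_inner_signed]
      have := hs.corr _ _ h
      linarith
    have h5 := abs_le_of_sq_le_sq' h4 (by norm_num)
    linarith [h5.2]

theorem eq_of_norm_sub_signed_sq_le {x : Vec D} {k l : Fin K × ℤˣ} {ε : ℝ} (hε : ε < 1 / 4)
    (hk : ‖x - signed a k‖ ^ 2 ≤ ε) (hl : ‖x - signed a l‖ ^ 2 ≤ ε) : k = l := by
  by_contra hkl
  have h1 := hs.one_le_norm_signed_sub_sq hkl
  have h2 := norm_sub_le (x - signed a l) (x - signed a k)
  rw [sub_sub_sub_cancel_left] at h2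
  have h3 := pow_le_pow_left₀ (norm_nonneg _) h2 2
  nlinarith [sq_nonneg (‖x - signed a l‖ - ‖x - signed a k‖)]

/-- Every second-order critical point in the superlevel set lies in a cap. -/
theorem exists_cap_of_mem_criticalAbove {B : Submodule ℝ (Tensor n D)}
    (hΔ : subspaceError (powSpan n a) B ≤ tolerance n c) {x : Vec D}
    (hx : x ∈ criticalAbove B (c / tolerance n c ^ 2 * (K * β ^ n)
      + 5 * subspaceError (powSpan n a) B)) :
    ∃ k, x ∈ componentCap n a c k ∧ 1 - capHeight n c < inner ℝ x (signed a k) := by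
  obtain ⟨i, hi⟩ := hs.exists_lt_sq_inner hΔ hx.1 hx.2
  obtain ⟨s, h⟩ := hs.exists_mem_componentCap (by simpa [unitSphere] using hx.1.1) hi
  exact ⟨(i, s), h⟩

/-- The landscape of the objective for a system with small parameters. -/
theorem landscape (B : Submodule ℝ (Tensor n D)) {Δ : ℝ}
    (hΔdef : Δ = subspaceError (powSpan n a) B) (hΔ : Δ ≤ tolerance n c) {ℓ : ℝ}
    (hℓ : ℓ = c / tolerance n c ^ 2 * (K * β ^ n) + 5 * Δ) :
    (criticalAbove B ℓ).ncard = 2 * K ∧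
    (∀ x ∈ criticalAbove B ℓ, IsStrictLocalMaxOnSphere (objective B) x ∧
      ∃! k : Fin K × ℤˣ, ‖x - ((k.2 : ℤ) : ℝ) • a k.1‖ ^ 2 ≤ 2 * Δ / n) ∧
    (Δ = 0 → criticalAbove B ℓ = signedComponents a ∧
      {x | x ∈ unitSphere D ∧ IsMaxOn (objective B) (unitSphere D) x} = signedComponents a) := by
  subst hΔdef hℓ
  set Δ := subspaceError (powSpan n a) B with hΔdef
  set ℓ := c / tolerance n c ^ 2 * (K * β ^ n) + 5 * Δ with hℓ
  obtain ⟨hτ, hτr, hr, -⟩ := hs.tolerance_bounds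
  have hc := hs.one_le
  have hn : (0 : ℝ) < n := by have := hs.two_le_n; positivity
  have hn2 : (2 : ℝ) ≤ n := by exact_mod_cast hs.two_le_n
  have hsmall : 2 * Δ / n < 1 / 4 := by
    rw [div_lt_iff₀ hn]; linarith
  have hlevel : ℓ ≤ 1 - Δ := by
    have h1 : c / tolerance n c ^ 2 * (K * β ^ n)
        ≤ c / tolerance n c ^ 2 * (tolerance n c ^ 2 / (2 * c)) := by
      gcongr; exact hs.tail_small
    have h2 : c / tolerance n c ^ 2 * (tolerance n c ^ 2 / (2 * c)) = 1 / 2 := by field_simp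
    linarith
  have hdist : ∀ x ∈ criticalAbove B ℓ, ∃ k, x ∈ componentCap n a c k ∧
      1 - capHeight n c < inner ℝ x (signed a k) ∧ ‖x - signed a k‖ ^ 2 ≤ 2 * Δ / n := by
    intro x hx
    obtain ⟨k, hk, hk'⟩ := hs.exists_cap_of_mem_criticalAbove hΔ hx
    exact ⟨k, hk, hk', hs.norm_sub_signed_sq_le hΔ hk hx.1.2.1⟩
  choose X hXcap hXcrit hXval using hs.exists_critical_mem_componentCap hΔ
  have hXmem : ∀ k, X k ∈ criticalAbove B ℓ := fun k => ⟨hXcrit k, hlevel.trans (hXval k)⟩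
  have hXdist : ∀ k, ‖X k - signed a k‖ ^ 2 ≤ 2 * Δ / n := fun k =>
    hs.norm_sub_signed_sq_le hΔ (hXcap k) (hXcrit k).2.1
  have hXinj : Function.Injective X := fun k l hkl =>
    hs.eq_of_norm_sub_signed_sq_le hsmall (hXdist k) (hkl ▸ hXdist l)
  have hcap : ∀ {k x y}, x ∈ componentCap n a c k → y ∈ componentCap n a c k →
      sphereGrad (objective B) x = 0 → sphereGrad (objective B) y = 0 → x = y := by
    intro k x y hx hy hgx hgy
    rcases le_total (objective B x) (objective B y) with h | h
    · exact hs.eq_of_mem_componentCap hΔ hx hy hgx h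
    · exact (hs.eq_of_mem_componentCap hΔ hy hx hgy h).symm
  have hrange : criticalAbove B ℓ = Set.range X := by
    refine Set.Subset.antisymm (fun x hx => ?_) (Set.range_subset_iff.2 hXmem)
    obtain ⟨k, hk, -⟩ := hdist x hx
    exact ⟨k, hcap (hXcap k) hk (hXcrit k).2.1 hx.1.2.1⟩
  refine ⟨?_, fun x hx => ?_, fun h0 => ?_⟩
  · rw [hrange, ← Set.image_univ, Set.ncard_image_of_injective _ hXinj, Set.ncard_univ,
      Nat.card_prod]
    simp [mul_comm]
  · obtain ⟨k, hk, hk', hkd⟩ := hdist x hx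
    refine ⟨⟨hx.1.1, ?_⟩, k, hkd, fun l hl => hs.eq_of_norm_sub_signed_sq_le hsmall hl hkd⟩
    have hcont : Continuous fun y : Vec D => (inner ℝ y (signed a k) : ℝ) :=
      continuous_id.inner continuous_const
    filter_upwards [hcont.continuousAt.eventually (lt_mem_nhds hk')] with y hy hy1 hyx
    have hycap : y ∈ componentCap n a c k := ⟨by simpa [unitSphere] using hy1, hy.le⟩
    by_contra! hcon
    exact hyx (hs.eq_of_mem_componentCap hΔ hk hycap hx.1.2.1 hcon).symm
  · have heq : ∀ {x k}, ‖x - signed a k‖ ^ 2 ≤ 2 * Δ / n → x = signed a k := by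
      intro x k h
      rw [h0, mul_zero, zero_div] at h
      rw [← sub_eq_zero, ← norm_eq_zero]
      exact (pow_eq_zero_iff two_ne_zero).1 (le_antisymm h (sq_nonneg _))
    have hXeq : ∀ k, X k = signed a k := fun k => heq (hXdist k)
    have hcomp : signedComponents a = Set.range (signed a) := by
      ext x
      simp [signedComponents, signed, eq_comm]
    refine ⟨?_, ?_⟩
    · rw [hrange, hcomp, funext hXeq]
    rw [hcomp]
    ext x
    constructor
    · rintro ⟨hx, hmax⟩
      have hx1 : ‖x‖ = 1 := by simpa [unitSphere] using hx
      have hsphere : ∀ k, signed a k ∈ unitSphere D := fun k => by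
        simpa [unitSphere] using hs.norm_signed k
      have hval : ∀ k, 1 ≤ objective B (signed a k) := fun k => by
        linarith [hs.one_sub_le_objective_signed B k]
      have : Nonempty (Fin K) := ⟨⟨0, hs.nonempty⟩⟩
      obtain ⟨i, -, himax⟩ := Finset.exists_max_image Finset.univ
        (fun j => inner ℝ (a j) x ^ 2) Finset.univ_nonempty
      have h1 := hs.objective_le_add_tolerance x hx1 (sq_nonneg (inner ℝ (a i) x : ℝ))
        ((sq_le_one_iff_abs_le_one _).2 (hs.abs_inner_le i hx1))
        fun j => himax j (Finset.mem_univ j)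
      have h2 := (abs_le.1 (abs_objective_sub_le (powSpan n a) B hx1)).1
      have h3 : 1 ≤ objective B x := (hval (i, 1)).trans (hmax (hsphere (i, 1)))
      obtain ⟨s, hs1, -⟩ := hs.exists_mem_componentCap (i := i) hx1 (by linarith)
      refine ⟨(i, s), hs.eq_of_mem_componentCap hΔ (hs.signed_mem_componentCap _) hs1 ?_
        (hmax (hsphere _))⟩
      rw [← hXeq]
      exact (hXcrit _).2.1
    · rintro ⟨k, rfl⟩
      refine ⟨by simpa [unitSphere] using hs.norm_signed k, fun y hy => ?_⟩
      have h1 := hs.one_sub_le_objective_signed B k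
      have h2 := objective_le_one B (x := y) (by simpa [unitSphere] using hy)
      change objective B y ≤ objective B (signed a k)
      linarith

end

end IsSmallSystem

end SPM

namespace SPM

/-! ### The asymptotic regime -/

/-- In the asymptotic regime, the assumptions of restricted isometry, correlation and Grammian give
an incoherent system with small parameters. With `β = (c₁ + 2 / cδ) log K / D` the quantity
`K β ^ n` is a constant multiple of `ε_K`, and `p β ≥ 2` for the order `p` of the restricted
isometry assumption. -/
theorem isSmallSystem_of_assumptions {n D K : ℕ} (hn : 2 ≤ n) {a : Fin K → Vec D}
    {c₁ c₂ cδ δ : ℝ} (hc₁ : 0 < c₁) (hcδ : 0 < cδ) (hD : 0 < D) (hK : 2 ≤ K)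
    (hδ0 : 0 < δ) (hδ : δ < tolerance n (max c₂ 1))
    (heps : (c₁ + 2 / cδ) ^ n * epsK n K D
      ≤ (tolerance n (max c₂ 1) ^ 2 / (2 * max c₂ 1)) ^ n)
    (ha : ∀ i, ‖a i‖ = 1) (hrip : AssumptionRIP a cδ δ) (hcorr : AssumptionCorrelation a c₁)
    (hgram : AssumptionGrammian n a c₂) :
    IsSmallSystem n a (max c₂ 1) ((c₁ + 2 / cδ) * (Real.log K / D)) δ
      ⌈cδ * D / Real.log K⌉₊ := by
  set c := max c₂ 1 with hcdef
  have hc : 1 ≤ c := le_max_right _ _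
  set M := c₁ + 2 / cδ with hM
  have hlog : 0 < Real.log K := Real.log_pos (by exact_mod_cast hK)
  have hτ := tolerance_pos hn hc
  have hτ1 : tolerance n c ≤ 1 := by
    linarith [mul_tolerance_le hn hc, capHeight_le hn hc]
  set b := tolerance n c ^ 2 / (2 * c) with hb
  have hb0 : 0 < b := by positivity
  have hb1 : b ≤ 1 := by
    rw [hb, div_le_one (by positivity)]
    have := pow_le_one₀ (n := 2) hτ.le hτ1
    linarith
  set β := M * (Real.log K / D) with hβdef
  have hβ : 0 < β := by positivity
  have htail : K * β ^ n = M ^ n * epsK n K D := by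
    rw [hβdef, epsK, mul_pow, div_pow]; ring
  rw [← htail] at heps
  have hK1 : (1 : ℝ) ≤ K := by exact_mod_cast (by omega : 1 ≤ K)
  have hβb : β ≤ b := by
    refine (pow_le_pow_iff_left₀ hβ.le hb0.le (by omega : n ≠ 0)).1 (le_trans ?_ heps)
    exact le_mul_of_one_le_left (by positivity) hK1
  exact
    { norm_eq := ha
      corr := fun i j hij => (hcorr i j hij).trans (by
        rw [hβdef, mul_div_assoc]
        have : c₁ ≤ M := le_add_of_nonneg_right (by positivity)
        gcongr)
      gram := fun σ => (sum_sq_le_of_assumptionGrammian hgram σ).trans (by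
        gcongr; exact le_max_left _ _)
      bessel := fun S hS y => sum_inner_sq_le_of_isRIP hrip hS y
      le_mul := by
        have h1 : cδ * D / Real.log K ≤ ⌈cδ * D / Real.log K⌉₊ := Nat.le_ceil _
        have h2 : cδ * D / Real.log K * β = c₁ * cδ + 2 := by
          rw [hβdef, hM]; field_simp
        have h3 := mul_le_mul_of_nonneg_right h1 hβ.le
        have h4 : 0 < c₁ * cδ := by positivity
        linarith
      β_pos := hβ
      β_le := hβb.trans hb1
      δ_nonneg := hδ0.le
      δ_le := hδ.le.trans hτ1
      one_le := hc
      two_le_n := hn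
      δ_small := hδ.le
      β_small := hβb
      tail_small := heps.trans (pow_le_of_le_one hb0.le hb1 (by omega))
      nonempty := by omega }

end SPM

theorem theorem2 (n : ℕ) (hn : 2 ≤ n) (c₁ c₂ : ℝ) (hc₁ : 0 < c₁) (hc₂ : 0 < c₂) :
    ∃ δ₀ : ℝ, 0 < δ₀ ∧
    ∀ cδ : ℝ, 0 < cδ →
    ∃ C Δ₀ : ℝ, 0 < C ∧ 0 < Δ₀ ∧
    ∀ K : ℕ → ℕ, Tendsto (fun D => SPM.epsK n (K D) D) atTop (𝓝 0) →
    ∃ D₀ : ℕ, ∀ D : ℕ, D₀ < D → 2 ≤ K D →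
    ∀ δ : ℝ, 0 < δ → δ < δ₀ →
    ∀ a : Fin (K D) → SPM.Vec D, (∀ i, ‖a i‖ = 1) →
      SPM.AssumptionRIP a cδ δ →
      SPM.AssumptionCorrelation a c₁ →
      SPM.AssumptionGrammian n a c₂ →
    ∀ Ahat : Submodule ℝ (SPM.Tensor n D), Ahat ≤ SPM.symTensors n D →
    ∀ Δ : ℝ, Δ = SPM.subspaceError (SPM.powSpan n a) Ahat → Δ ≤ Δ₀ →
      (SPM.criticalAbove Ahat (C * SPM.epsK n (K D) D + 5 * Δ)).ncard = 2 * K D ∧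
      (∀ x ∈ SPM.criticalAbove Ahat (C * SPM.epsK n (K D) D + 5 * Δ),
        SPM.IsStrictLocalMaxOnSphere (SPM.objective Ahat) x ∧
        ∃! p : Fin (K D) × ℤˣ, ‖x - ((p.2 : ℤ) : ℝ) • a p.1‖ ^ 2 ≤ 2 * Δ / n) ∧
      (Δ = 0 →
        SPM.criticalAbove Ahat (C * SPM.epsK n (K D) D + 5 * Δ) = SPM.signedComponents a ∧
        {x | x ∈ SPM.unitSphere D ∧ IsMaxOn (SPM.objective Ahat) (SPM.unitSphere D) x} =
          SPM.signedComponents a) := by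
  set c := max c₂ 1 with hcdef
  have hc : 1 ≤ c := le_max_right _ _
  have hτ := SPM.tolerance_pos hn hc
  refine ⟨SPM.tolerance n c, hτ, fun cδ hcδ => ?_⟩
  set M := c₁ + 2 / cδ with hM
  have hM0 : 0 < M := by positivity
  refine ⟨c / SPM.tolerance n c ^ 2 * M ^ n, SPM.tolerance n c, by positivity, hτ, fun K hK => ?_⟩
  have hev : ∀ᶠ D in atTop, M ^ n * SPM.epsK n (K D) D
      < (SPM.tolerance n c ^ 2 / (2 * c)) ^ n := by
    have h := hK.const_mul (M ^ n)
    rw [mul_zero] at h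
    exact h.eventually (gt_mem_nhds (by positivity))
  obtain ⟨D₀, hD₀⟩ := eventually_atTop.1 hev
  refine ⟨D₀, fun D hD hKD δ hδ0 hδ a ha hrip hcorr hgram Ahat _ Δ hΔdef hΔ => ?_⟩
  have hs := SPM.isSmallSystem_of_assumptions hn hc₁ hcδ (by omega) hKD hδ0 hδ (hD₀ D hD.le).le
    ha hrip hcorr hgram
  refine hs.landscape Ahat hΔdef hΔ ?_
  rw [SPM.epsK, mul_pow, div_pow]
  ring
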